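/- Let $0<T<\infty$, $\mathbb T=[0,T]$, let $\lambda$ be Lebesgue measure on $\mathbb T$, $(S,\Sigma,\nu)$ a $\sigma$-finite measure space, $S_{\mathbb T}=S\times\mathbb T$, $\mu=\nu\otimes\lambda$, and let $H$ be a separable (real or complex) Hilbert space. Let $p$ be a Poisson random measure on $S_{\mathbb T}$ with intensity measure $\mu$, defined on a probability space $(\Omega,\mathcal F,\mathbb P)$: every $p(\omega,\cdot)$ is a measure with values in $\{0,1,2,\dots\}\cup\{\infty\}$, every $p(B)$ is Poisson distributed with parameter $\mu(B)$ (with $p(B)=\infty$ a.s. if $\mu(B)=\infty$), and $p(B_1),\dots,p(B_M)$ are independent for pairwise disjoint $B_1,\dots,B_M$. Let $q(B)=p(B)-\mu(B)$ for $\mu(B)<\infty$, and write $q(t,A)=q(A\times(0,t])$. Assume that $\mathcal F$ and the filtration $(\mathcal F_t)_{t\in\mathbb T}$ are generated by $q$ up to $\mathbb P$-null sets: for every $t\in\mathbb T$, with $\mathcal G_t=\sigma\big(q(A\times(r,s]) : 0\le r<s\le t,\ A\in\Sigma,\ \nu(A)<\infty\big)$, one has $\mathcal G_t\subseteq\mathcal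 F_t\subseteq\mathcal F$, every set in $\mathcal F_t$ agrees up to a $\mathbb P$-null set with a set in $\mathcal G_t$, and every set in $\mathcal F$ agrees up to a $\mathbb P$-null set with a set in $\mathcal G_T$. **Itô integral.** An elementary process is $\Phi=\sum_{n=0}^{N-1}\sum_{m=1}^{M_n}\Phi_m^n\mathbf 1_{(t_n,t_{n+1}]\times A_m^n}$ with $0=t_0<\dots<t_N=T$, for each $n$ pairwise disjoint $A_m^n\in\Sigma$ of finite $\nu$-measure, and $\mathcal F_{t_n}$-measurable $\Phi_m^n\in L^2(\Omega;H)$; for it $I(\Phi)(t)=\sum_{n,m}\Phi_m^n\big(q(t_{n+1}\wedge t,A_m^n)-q(t_n\wedge t,A_m^n)\big)$. Let $\mathcal N_q^2(S_{\mathbb T};H)$ be the space of (classes of) functions in $L^2(\Omega\times S_{\mathbb T},\mathbb P\otimes\mu;H)$ that are measurable with respect to the predictable $\sigma$-algebra, i.e. the one generated by the sets $F\times(s,t]\times A$ ($0\le s<t\le T$, $F\in\mathcal F_s$, $A\in\Sigma$) and $F\times\{0\}\times A$ ($F\in\mathcal F_0$, $A\in\Sigma$). The Itô integral $\Phi\mapsto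 I(\Phi)(T)\in L^2(\Omega;H)$ on $\mathcal N_q^2(S_{\mathbb T};H)$ is the continuous extension of the elementary one. **Divergence.** A cylindrical random variable is $F=\sum_{i=1}^n f_i(p(B_1),\dots,p(B_M))h_i$ with pairwise disjoint measurable $B_m\subseteq S_{\mathbb T}$ with $\mu(B_m)<\infty$, $f_i:\mathbb Z_+^M\to\mathbb R$ and $h_i\in H$; its derivative is, with $p(\mathbf B)=(p(B_1),\dots,p(B_M))$ and $e_m$ the $m$-th unit vector, $$DF=\sum_{i=1}^n\sum_{m=1}^M\big(f_i(p(\mathbf B)+e_m)-f_i(p(\mathbf B))\big)\mathbf 1_{B_m}h_i .$$ The Malliavin derivative $D$ is the closure of this (closable, densely defined) operator from $L^2(\Omega;H)$ to $L^2(\Omega\times S_{\mathbb T};H)$, initially defined on those cylindrical $F$ with $F\in L^2(\Omega;H)$ and $DF\in L^2(\Omega\times S_{\mathbb T};H)$. The divergence operator $\delta:\operatorname{dom}(\delta)\subseteq L^2(\Omega\times S_{\mathbb T};H)\to L^2(\Omega;H)$ is the adjoint of $D$. **Proposition.** For every $\Phi\in\mathcal N_q^2(S_{\mathbb T};H)$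 one has $\Phi\in\operatorname{dom}(\delta)$ and $$\delta(\Phi)=I(\Phi)(T)\quad\text{in }L^2(\Omega;H).$$ -/

import Mathlib

open MeasureTheory ProbabilityTheory
open scoped ENNReal NNReal

noncomputable section

namespace PoissonMalliavin

/-- The time interval `[0, T]`. -/
abbrev Time (T : ℝ) : Type := Set.Icc (0 : ℝ) T

/-- The intensity measure `ν ⊗ λ` on `S × [0, T]`, with `λ` the Lebesgue measure on `[0, T]`. -/
abbrev intensity {S : Type*} [MeasurableSpace S] (ν : Measure S) (T : ℝ) :
    Measure (S × Time T) :=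
  ν.prod (Measure.comap (Subtype.val : Time T → ℝ) volume)

/-- `p` is a Poisson random measure with intensity measure `μ`: each `p ω` is a measure with values
in `{0, 1, 2, …} ∪ {∞}`, each `p(B)` is a Poisson distributed random variable with parameter `μ(B)`
(which means that `p(B) = ∞` almost surely if `μ(B) = ∞`), and `p` takes independent values on
pairwise disjoint sets. -/
structure IsPoissonRandomMeasure {Ω E : Type*} [MeasurableSpace Ω] [MeasurableSpace E]
    (p : Ω → Measure E) (μ : Measure E) (P : Measure Ω) : Prop where
  integer_valued : ∀ ω B, MeasurableSet B → ∃ n : ℕ∞, p ω B = (n : ℝ≥0∞)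
  measurable : ∀ B, MeasurableSet B → Measurable (fun ω => p ω B)
  law_of_finite : ∀ B, MeasurableSet B → μ B < ∞ →
    P.map (fun ω => p ω B) = (poissonMeasure (μ B).toNNReal).map (fun n : ℕ => (n : ℝ≥0∞))
  law_of_infinite : ∀ B, MeasurableSet B → μ B = ∞ → ∀ᵐ ω ∂P, p ω B = ∞
  indep : ∀ (M : ℕ) (B : Fin M → Set E), (∀ m, MeasurableSet (B m)) →
    Pairwise (fun i j => Disjoint (B i) (B j)) → iIndepFun (fun m ω => p ω (B m)) P

/-- The compensated random measure `q(B) = p(B) - μ(B)` (for `μ(B) < ∞`). -/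
def compensated {Ω E : Type*} [MeasurableSpace E] (p : Ω → Measure E) (μ : Measure E)
    (B : Set E) (ω : Ω) : ℝ :=
  (p ω B).toReal - (μ B).toReal

/-! ### The filtration generated by `q`, and predictable processes -/

/-- `σ(q((r, s] × A) : 0 ≤ r < s ≤ t, A ∈ Σ, ν(A) < ∞)`. -/
abbrev generatedSigma {Ω S : Type*} [MeasurableSpace S] {T : ℝ} (p : Ω → Measure (S × Time T))
    (ν : Measure S) (t : Time T) : MeasurableSpace Ω :=
  MeasurableSpace.generateFrom
    {C | ∃ (r s : Time T) (A : Set S) (D : Set ℝ), r < s ∧ s ≤ t ∧ MeasurableSet A ∧ ν A < ∞ ∧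
      MeasurableSet D ∧ C = compensated p (intensity ν T) (A ×ˢ Set.Ioc r s) ⁻¹' D}

/-- The `σ`-algebra `m` enlarged by the sets that agree with a set of `m` up to a `P`-null set. -/
abbrev augmented {Ω : Type*} [MeasurableSpace Ω] (P : Measure Ω) (m : MeasurableSpace Ω) :
    MeasurableSpace Ω :=
  eventuallyMeasurableSpace m (ae P)

/-- The filtration `𝓕` is generated by `q`, up to `P`-null sets. This holds for the raw filtration
`generatedSigma p ν` and also, on a complete probability space, for its augmentation. -/
structure IsGeneratedFiltration {Ω S : Type*} {mΩ : MeasurableSpace Ω} [MeasurableSpace S] {T : ℝ}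
    (P : Measure Ω) (p : Ω → Measure (S × Time T)) (ν : Measure S)
    (𝓕 : Filtration (Time T) mΩ) : Prop where
  generated_le : ∀ t, generatedSigma p ν t ≤ 𝓕 t
  le_augmented : ∀ t, 𝓕 t ≤ augmented P (generatedSigma p ν t)

/-- The `σ`-algebra of predictable sets, on `Ω × (S × [0, T])`. -/
abbrev predictableSigma {Ω : Type*} (S : Type*) {mΩ : MeasurableSpace Ω} [MeasurableSpace S] {T : ℝ}
    (𝓕 : Filtration (Time T) mΩ) : MeasurableSpace (Ω × (S × Time T)) :=
  MeasurableSpace.generateFrom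
    ({C | ∃ (s t : Time T) (F : Set Ω) (A : Set S), s < t ∧ MeasurableSet[𝓕 s] F ∧
        MeasurableSet A ∧ C = F ×ˢ (A ×ˢ Set.Ioc s t)} ∪
     {C | ∃ (s : Time T) (F : Set Ω) (A : Set S), (s : ℝ) = 0 ∧ MeasurableSet[𝓕 s] F ∧
        MeasurableSet A ∧ C = F ×ˢ (A ×ˢ {s})})

/-- `L²(Ω; H)`. -/
abbrev L2Omega {Ω : Type*} [MeasurableSpace Ω] (P : Measure Ω) (H : Type*)
    [NormedAddCommGroup H] : Type _ :=
  Lp H 2 P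

/-- `L²(Ω × S × [0, T]; H)` with respect to `P ⊗ ν ⊗ λ`. -/
abbrev L2Product {Ω S : Type*} [MeasurableSpace Ω] [MeasurableSpace S] (P : Measure Ω)
    (ν : Measure S) (T : ℝ) (H : Type*) [NormedAddCommGroup H] : Type _ :=
  Lp H 2 (P.prod (intensity ν T))

/-- The space of predictable square-integrable integrands: the classes in
`L²(Ω × S × [0, T]; H)` that have a predictable representative. -/
def predictableL2 {Ω S : Type*} (𝕜 : Type*) [RCLike 𝕜] {mΩ : MeasurableSpace Ω}
    [MeasurableSpace S] {T : ℝ} (P : Measure Ω) (ν : Measure S) (𝓕 : Filtration (Time T) mΩ)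
    (H : Type*) [NormedAddCommGroup H] [InnerProductSpace 𝕜 H] :
    Submodule 𝕜 (L2Product P ν T H) :=
  lpMeas H 𝕜 (predictableSigma S 𝓕) 2 (P.prod (intensity ν T))

/-! ### The Itô integral -/

/-- An elementary process `∑ₙ ∑ₘ Φₘⁿ 1_{(tₙ, tₙ₊₁] × Aₘⁿ}`. -/
structure ElementaryIntegrand {Ω S : Type*} {mΩ : MeasurableSpace Ω} [MeasurableSpace S] {T : ℝ}
    (P : Measure Ω) (ν : Measure S) (𝓕 : Filtration (Time T) mΩ)
    (H : Type*) [NormedAddCommGroup H] where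
  N : ℕ
  t : Fin (N + 1) → Time T
  t_strictMono : StrictMono t
  t_zero : (t 0 : ℝ) = 0
  t_last : (t (Fin.last N) : ℝ) = T
  M : Fin N → ℕ
  A : (n : Fin N) → Fin (M n) → Set S
  measurableSet_A : ∀ n m, MeasurableSet (A n m)
  measure_A_lt_top : ∀ n m, ν (A n m) < ∞
  disjoint_A : ∀ n, Pairwise (fun i j => Disjoint (A n i) (A n j))
  coeff : (n : Fin N) → Fin (M n) → Ω → H
  coeff_measurable : ∀ n m, StronglyMeasurable[𝓕 (t n.castSucc)] (coeff n m)
  coeff_memLp : ∀ n m, MemLp (coeff n m) 2 P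

namespace ElementaryIntegrand

variable {Ω S : Type*} {mΩ : MeasurableSpace Ω} [MeasurableSpace S] {T : ℝ}
  {P : Measure Ω} {ν : Measure S} {𝓕 : Filtration (Time T) mΩ}
  {H : Type*} [NormedAddCommGroup H]

/-- The process itself, as a function on `Ω × (S × [0, T])`. -/
def toIntegrand (Φ : ElementaryIntegrand P ν 𝓕 H) (x : Ω × (S × Time T)) : H :=
  ∑ n, ∑ m, (Φ.A n m ×ˢ Set.Ioc (Φ.t n.castSucc) (Φ.t n.succ)).indicator
    (fun _ => Φ.coeff n m x.1) x.2

/-- `q(t, A) = q((0, t] × A)`. -/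
def noise (p : Ω → Measure (S × Time T)) (ν : Measure S) (t : Time T) (A : Set S) (ω : Ω) : ℝ :=
  compensated p (intensity ν T) (A ×ˢ {u : Time T | 0 < (u : ℝ) ∧ u ≤ t}) ω

/-- `I(Φ)(t) = ∑ₙ ∑ₘ (q(tₙ₊₁ ∧ t, Aₘⁿ) - q(tₙ ∧ t, Aₘⁿ)) Φₘⁿ`. -/
def integral (𝕜 : Type*) [RCLike 𝕜] [InnerProductSpace 𝕜 H]
    (Φ : ElementaryIntegrand P ν 𝓕 H) (p : Ω → Measure (S × Time T)) (t : Time T) (ω : Ω) : H :=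
  ∑ n, ∑ m, ((noise p ν (min (Φ.t n.succ) t) (Φ.A n m) ω
    - noise p ν (min (Φ.t n.castSucc) t) (Φ.A n m) ω : ℝ) : 𝕜) • Φ.coeff n m ω

end ElementaryIntegrand

/-- The graph of `Φ ↦ I(Φ)(t)` on elementary processes. -/
def elementaryGraph {Ω S : Type*} (𝕜 : Type*) [RCLike 𝕜] {mΩ : MeasurableSpace Ω}
    [MeasurableSpace S] {T : ℝ} (P : Measure Ω) (ν : Measure S) (p : Ω → Measure (S × Time T))
    (𝓕 : Filtration (Time T) mΩ) (H : Type*) [NormedAddCommGroup H] [InnerProductSpace 𝕜 H]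
    (t : Time T) : Submodule 𝕜 (L2Product P ν T H × L2Omega P H) :=
  Submodule.span 𝕜
    {z | ∃ e : ElementaryIntegrand P ν 𝓕 H,
      z.1 =ᵐ[P.prod (intensity ν T)] e.toIntegrand ∧ z.2 =ᵐ[P] e.integral 𝕜 p t}

/-- The Itô integral `Φ ↦ I(Φ)(t)`: the continuous extension of the elementary integral, that is,
the operator whose graph is the closure of the graph of the elementary integral. (For a Poisson
random measure the elementary integral is a contraction, isometric for `t = T`, so that this closure
is a graph.) -/
def itoIntegral {Ω S : Type*} (𝕜 : Type*) [RCLike 𝕜] {mΩ : MeasurableSpace Ω}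
    [MeasurableSpace S] {T : ℝ} (P : Measure Ω) (ν : Measure S) (p : Ω → Measure (S × Time T))
    (𝓕 : Filtration (Time T) mΩ) (H : Type*) [NormedAddCommGroup H] [InnerProductSpace 𝕜 H]
    (t : Time T) : L2Product P ν T H →ₗ.[𝕜] L2Omega P H :=
  (elementaryGraph 𝕜 P ν p 𝓕 H t).topologicalClosure.toLinearPMap

/-! ### The Malliavin derivative and the divergence -/

/-- The data `B₁, …, B_M` (pairwise disjoint, of finite measure), `fᵢ : ℕ^M → ℝ`, `hᵢ ∈ H` that
represent a cylindrical random variable. -/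
structure Cylinder {E : Type*} [MeasurableSpace E] (μ : Measure E) (H : Type*) where
  M : ℕ
  n : ℕ
  B : Fin M → Set E
  measurableSet_B : ∀ m, MeasurableSet (B m)
  measure_B_lt_top : ∀ m, μ (B m) < ∞
  disjoint_B : Pairwise (fun i j => Disjoint (B i) (B j))
  f : Fin n → (Fin M → ℕ) → ℝ
  h : Fin n → H

namespace Cylinder

variable {Ω E : Type*} [MeasurableSpace E] {μ : Measure E} {H : Type*} [NormedAddCommGroup H]

/-- `p(𝐁) = (p(B₁), …, p(B_M))`, as a vector of natural numbers (the `p(Bₘ)` are almost surely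
finite). -/
def counts (F : Cylinder μ H) (p : Ω → Measure E) (ω : Ω) : Fin F.M → ℕ :=
  fun m => ⌊(p ω (F.B m)).toReal⌋₊

/-- The random variable `∑ᵢ fᵢ(p(𝐁)) hᵢ`. -/
def toRV (𝕜 : Type*) [RCLike 𝕜] [InnerProductSpace 𝕜 H] (F : Cylinder μ H) (p : Ω → Measure E)
    (ω : Ω) : H :=
  ∑ i, ((F.f i (F.counts p ω) : ℝ) : 𝕜) • F.h i

/-- `∑ᵢ ∑ₘ (fᵢ(p(𝐁) + eₘ) - fᵢ(p(𝐁))) 1_{Bₘ} hᵢ`. -/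
def derivative (𝕜 : Type*) [RCLike 𝕜] [InnerProductSpace 𝕜 H] (F : Cylinder μ H)
    (p : Ω → Measure E) (x : Ω × E) : H :=
  ∑ i, ∑ m, (F.B m).indicator
    (fun _ => ((F.f i (F.counts p x.1 + Pi.single m 1) - F.f i (F.counts p x.1) : ℝ) : 𝕜) • F.h i)
    x.2

end Cylinder

/-- The graph of the Malliavin derivative on those cylindrical random variables `F` for which `F`
and `DF` are square-integrable. -/
def cylindricalGraph {Ω S : Type*} (𝕜 : Type*) [RCLike 𝕜] [MeasurableSpace Ω]
    [MeasurableSpace S] {T : ℝ} (P : Measure Ω) (ν : Measure S) (p : Ω → Measure (S × Time T))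
    (H : Type*) [NormedAddCommGroup H] [InnerProductSpace 𝕜 H] :
    Submodule 𝕜 (L2Omega P H × L2Product P ν T H) :=
  Submodule.span 𝕜
    {z | ∃ F : Cylinder (intensity ν T) H,
      z.1 =ᵐ[P] F.toRV 𝕜 p ∧ z.2 =ᵐ[P.prod (intensity ν T)] F.derivative 𝕜 p}

/-- The Malliavin derivative `D`: the closure of the derivative on cylindrical random variables.
(For a Poisson random measure the derivative of cylindrical random variables is well defined and
closable, so that the closure of its graph is a graph.) Its domain is `𝔻^{1,2}(Ω; H)`. -/
def malliavinDerivative {Ω S : Type*} (𝕜 : Type*) [RCLike 𝕜] [MeasurableSpace Ω]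
    [MeasurableSpace S] {T : ℝ} (P : Measure Ω) (ν : Measure S) (p : Ω → Measure (S × Time T))
    (H : Type*) [NormedAddCommGroup H] [InnerProductSpace 𝕜 H] :
    L2Omega P H →ₗ.[𝕜] L2Product P ν T H :=
  (cylindricalGraph 𝕜 P ν p H).topologicalClosure.toLinearPMap

/-- The divergence operator `δ`, the Hilbert space adjoint of the Malliavin derivative. -/
def divergence {Ω S : Type*} (𝕜 : Type*) [RCLike 𝕜] [MeasurableSpace Ω]
    [MeasurableSpace S] {T : ℝ} (P : Measure Ω) (ν : Measure S) (p : Ω → Measure (S × Time T))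
    (H : Type*) [NormedAddCommGroup H] [InnerProductSpace 𝕜 H] [CompleteSpace H] :
    L2Product P ν T H →ₗ.[𝕜] L2Omega P H :=
  (malliavinDerivative 𝕜 P ν p H).adjoint

end PoissonMalliavin

end

/-!
The Itô integral is a restriction of the divergence because `Φ ↦ I(Φ)(T)` is in duality with the
Malliavin derivative: `⟪I(Φ), F⟫ = ⟪Φ, D F⟫` for predictable `Φ` and all `F` in the domain of `D`.

Everything rests on the Mecke formula, in the form
`IsPoissonRandomMeasure.withDensity_eq_map`: for `μ(D) < ∞`, the law of `p` with density `p(D)` is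
the law of `p + δ_x`, with `x` drawn from `μ` on `D` independently of `p`. It follows from the
identity `E[N g(N)] = r E[g(N + 1)]` for Poisson variables and the independence of `p` on disjoint
sets, after any finite family of sets has been refined to its atoms.

A cylindrical random variable is a functional `F(p)`, and its derivative is the difference
`F(p + δ_x) - F(p)`. By the Mecke formula, null sets for the law of `p` remain null after adding a
point, so this difference operator is closable (`cylindricalGraph_closable`).

Consider an integrand `φ(p) 1_D`, where `φ` ignores the points of `p` in `D`. With the functional
`⟪F(p), φ(p)⟫` in the Mecke formula one gets the integration by parts
`E⟪F(p), q(D) φ(p)⟫ = E ∫_D ⟪F(p + δ_x) - F(p), φ(p)⟫ μ(dx)`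
(`IsSimpleIntegrand.integral_inner_integral`). For cylindrical `F` this is the duality with `D`. For
`F(p) = q(D') φ'(p)`, whose difference is `φ'(p) 1_{D'}`, it is the Itô isometry. Adapted
coefficients are of the required form, since the filtration is generated by `q` up to null sets
(`IsGeneratedFiltration.exists_functional`).

The isometry and the density of the elementary integrands (`predictableL2_le_closure`) give the Itô
integral on all predictable integrands, and the duality passes to closures. The density of the
domain of `D` (`cylindricalGraph_dense`), which makes the adjoint single-valued, comes from the
assumption that all events are generated by `q` up to null sets.
-/

noncomputable section

namespace PoissonMalliavin

open Filter Topology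

/-! ### The atoms of a finite family of sets -/

section Atoms

variable {E ι : Type*}

/-- The atoms of the algebra of sets generated by the family `B`, indexed by the sets `s` of
indices that hold the point, and with the atom outside all `B i` replaced by the empty set. -/
def atom (B : ι → Set E) (s : Finset ι) : Set E := {x | s.Nonempty ∧ ∀ i, i ∈ s ↔ x ∈ B i}

theorem atom_subset {B : ι → Set E} {s : Finset ι} {i : ι} (hi : i ∈ s) : atom B s ⊆ B i :=
  fun _ hx => (hx.2 i).1 hi

theorem pairwise_disjoint_atom (B : ι → Set E) :
    Pairwise fun s t => Disjoint (atom B s) (atom B t) := fun _ _ hst =>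
  Set.disjoint_left.2 fun _ hs ht => hst (Finset.ext fun i => (hs.2 i).trans (ht.2 i).symm)

theorem biUnion_atom [Fintype ι] [DecidableEq ι] (B : ι → Set E) (i : ι) :
    ⋃ s ∈ Finset.univ.filter (fun s : Finset ι => i ∈ s), atom B s = B i := by
  classical
  ext x
  simp only [Finset.mem_filter, Finset.mem_univ, true_and, Set.mem_iUnion, exists_prop]
  constructor
  · rintro ⟨s, hi, hx⟩
    exact atom_subset hi hx
  · intro hx
    exact ⟨Finset.univ.filter fun j => x ∈ B j, by simpa using hx, ⟨i, by simpa using hx⟩,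
      fun j => by simp⟩

variable [MeasurableSpace E] {μ : Measure E}

theorem measurableSet_atom [Finite ι] {B : ι → Set E} (hB : ∀ i, MeasurableSet (B i))
    (s : Finset ι) : MeasurableSet (atom B s) := by
  refine measurableSet_setOfPred.2 (measurable_const.and (Measurable.forall fun i => ?_))
  exact measurable_const.iff (measurableSet_setOfPred.1 (hB i))

theorem measure_eq_sum_atom [Fintype ι] [DecidableEq ι] {B : ι → Set E}
    (hB : ∀ i, MeasurableSet (B i)) (m : Measure E) (i : ι) :
    m (B i) = ∑ s with i ∈ s, m (atom B s) := by
  conv_lhs => rw [← biUnion_atom B i]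
  exact measure_biUnion_finset (fun s _ t _ hst => pairwise_disjoint_atom B hst)
    fun s _ => measurableSet_atom hB s

theorem measure_atom_lt_top {B : ι → Set E} (hB : ∀ i, μ (B i) < ∞) (s : Finset ι) :
    μ (atom B s) < ∞ := by
  rcases s.eq_empty_or_nonempty with rfl | ⟨i, hi⟩
  · simp [atom]
  · exact (measure_mono (atom_subset hi)).trans_lt (hB i)

end Atoms

/-! ### The Mecke formula -/

section Mecke

variable {Ω E ι : Type*} [MeasurableSpace Ω] [MeasurableSpace E] {p : Ω → Measure E}
  {μ : Measure E} {P : Measure Ω}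

/-- The Chen–Stein identity `E[N g(N)] = r E[g(N + 1)]` for a Poisson variable `N` of rate `r`. -/
theorem lintegral_poissonMeasure_natCast_mul (r : ℝ≥0) (g : ℕ → ℝ≥0∞) :
    ∫⁻ n, (n : ℝ≥0∞) * g n ∂(poissonMeasure r) = r * ∫⁻ n, g (n + 1) ∂(poissonMeasure r) := by
  have key (f : ℕ → ℝ≥0∞) : ∫⁻ n, f n ∂(poissonMeasure r)
      = ∑' n, ENNReal.ofReal (Real.exp (-r) * r ^ n / n.factorial) * f n := by
    simp [poissonMeasure, lintegral_sum_measure, lintegral_smul_measure, lintegral_dirac]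
  rw [key, key, tsum_eq_zero_add' ENNReal.summable, ← ENNReal.tsum_mul_left]
  simp only [Nat.cast_zero, zero_mul, mul_zero, zero_add]
  refine tsum_congr fun n => ?_
  rw [← mul_assoc, ← mul_assoc]
  congr 1
  rw [← ENNReal.ofReal_natCast, ← ENNReal.ofReal_coe_nnreal, ← ENNReal.ofReal_mul (by positivity),
    ← ENNReal.ofReal_mul (by positivity)]
  congr 1
  rw [Nat.factorial_succ]
  push_cast
  field_simp
  ring

theorem IsPoissonRandomMeasure.measurable_measure (hp : IsPoissonRandomMeasure p μ P) :
    Measurable p := Measure.measurable_of_measurable_coe _ hp.measurable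

theorem IsPoissonRandomMeasure.iIndepFun_of_finite (hp : IsPoissonRandomMeasure p μ P) [Finite ι]
    {B : ι → Set E} (hB : ∀ i, MeasurableSet (B i))
    (hd : Pairwise fun i j => Disjoint (B i) (B j)) : iIndepFun (fun i ω => p ω (B i)) P := by
  obtain ⟨n, ⟨e⟩⟩ := Finite.exists_equiv_fin ι
  have h := hp.indep n (fun m => B (e.symm m)) (fun m => hB _)
    fun i j hij => hd (e.symm.injective.ne hij)
  simpa using h.precomp e.injective

theorem IsPoissonRandomMeasure.lintegral_mul_law (hp : IsPoissonRandomMeasure p μ P) {D : Set E}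
    (hD : MeasurableSet D) (hμD : μ D < ∞) {g : ℝ≥0∞ → ℝ≥0∞} (hg : Measurable g) :
    ∫⁻ n, n * g n ∂(P.map fun ω => p ω D) = μ D * ∫⁻ n, g (n + 1) ∂(P.map fun ω => p ω D) := by
  have hc : Measurable fun n : ℕ => (n : ℝ≥0∞) := measurable_from_top
  rw [hp.law_of_finite D hD hμD, lintegral_map (by fun_prop) hc, lintegral_map (by fun_prop) hc,
    lintegral_poissonMeasure_natCast_mul, ENNReal.coe_toNNReal hμD.ne]
  simp

/-- The Mecke formula for functions of the values of `p` on finitely many disjoint sets. -/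
theorem IsPoissonRandomMeasure.lintegral_mul_disjoint (hp : IsPoissonRandomMeasure p μ P)
    [IsProbabilityMeasure P] [Fintype ι] [DecidableEq ι]
    {B : ι → Set E} (hB : ∀ i, MeasurableSet (B i))
    (hd : Pairwise fun i j => Disjoint (B i) (B j)) (j : ι) (hj : μ (B j) < ∞)
    {g : (ι → ℝ≥0∞) → ℝ≥0∞} (hg : Measurable g) :
    ∫⁻ ω, p ω (B j) * g (fun i => p ω (B i)) ∂P
      = μ (B j) * ∫⁻ ω, g (fun i => p ω (B i) + if i = j then 1 else 0) ∂P := by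
  have hX := hp.measurable _ (hB j)
  -- The count `p(B j)` is independent of the counts in all other sets, and has a Poisson law.
  set R : Finset ι := Finset.univ.erase j
  let Y : Ω → R → ℝ≥0∞ := fun ω i => p ω (B i)
  have hY : Measurable Y := measurable_pi_lambda _ fun i => hp.measurable _ (hB i)
  have hind : IndepFun (fun ω => p ω (B j)) Y P := by
    have h := (hp.iIndepFun_of_finite hB hd).indepFun_finset {j} R (by simp [R])
      fun i => hp.measurable _ (hB i)
    exact h.comp (φ := fun a : ({j} : Finset ι) → ℝ≥0∞ => a ⟨j, by simp⟩) (ψ := id)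
      (measurable_pi_apply _) measurable_id
  let c : ℝ≥0∞ × (R → ℝ≥0∞) → ι → ℝ≥0∞ := fun z i => if h : i ∈ R then z.2 ⟨i, h⟩ else z.1
  have hc : Measurable c := measurable_pi_lambda _ fun i => by
    by_cases h : i ∈ R
    · simp only [c, h, dite_true]; fun_prop
    · simp only [c, h, dite_false]; fun_prop
  have hmap := hind.map_prod_eq_prod_map_map hX.aemeasurable hY.aemeasurable
  have : IsProbabilityMeasure (P.map fun ω => p ω (B j)) :=
    Measure.isProbabilityMeasure_map hX.aemeasurable
  have : IsProbabilityMeasure (P.map Y) := Measure.isProbabilityMeasure_map hY.aemeasurable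
  have key (f : ℝ≥0∞ × (R → ℝ≥0∞) → ℝ≥0∞) (hf : Measurable f) :
      ∫⁻ ω, f (p ω (B j), Y ω) ∂P
        = ∫⁻ y, ∫⁻ n, f (n, y) ∂(P.map fun ω => p ω (B j)) ∂(P.map Y) := by
    rw [← lintegral_prod_symm' _ hf, ← hmap, lintegral_map hf (hX.prodMk hY)]
  have h1 : ∀ ω, (fun i => p ω (B i)) = c (p ω (B j), Y ω) := fun ω => by
    ext i
    by_cases h : i = j <;> simp [c, R, Y, h]
  have h2 : ∀ ω, (fun i => p ω (B i) + if i = j then 1 else 0) =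
      c (p ω (B j) + 1, Y ω) := fun ω => by
    ext i
    by_cases h : i = j <;> simp [c, R, Y, h]
  simp_rw [h2, h1]
  rw [key (fun z => z.1 * g (c z)) (by fun_prop), key (fun z => g (c (z.1 + 1, z.2))) (by fun_prop),
    ← lintegral_const_mul' _ _ hj.ne]
  refine lintegral_congr fun y => ?_
  exact hp.lintegral_mul_law (hB j) hj (g := fun n => g (c (n, y))) (by fun_prop)

theorem measurable_add_dirac : Measurable fun z : Measure E × E => z.1 + Measure.dirac z.2 := by
  refine Measure.measurable_of_measurable_coe _ fun B hB => ?_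
  simp only [Measure.coe_add, Pi.add_apply, Measure.dirac_apply' _ hB]
  exact ((Measure.measurable_coe hB).comp measurable_fst).add
    ((measurable_one.indicator hB).comp measurable_snd)

theorem IsPoissonRandomMeasure.measurable_add_dirac (hp : IsPoissonRandomMeasure p μ P) :
    Measurable fun z : Ω × E => p z.1 + Measure.dirac z.2 :=
  PoissonMalliavin.measurable_add_dirac.comp
    ((hp.measurable_measure.comp measurable_fst).prodMk measurable_snd)

/-- The Mecke formula for functions of the values of `p` on finitely many sets, one of which is the
set over which the added point ranges. -/
theorem IsPoissonRandomMeasure.lintegral_mul_finite (hp : IsPoissonRandomMeasure p μ P)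
    [IsProbabilityMeasure P] [Fintype ι] [DecidableEq ι]
    {B : ι → Set E} (hB : ∀ i, MeasurableSet (B i)) (j : ι) (hj : μ (B j) < ∞)
    {g : (ι → ℝ≥0∞) → ℝ≥0∞} (hg : Measurable g) :
    ∫⁻ ω, p ω (B j) * g (fun i => p ω (B i)) ∂P
      = ∫⁻ x in B j, ∫⁻ ω, g (fun i => (p ω + Measure.dirac x) (B i)) ∂P ∂μ := by
  have hA (s : Finset ι) := measurableSet_atom hB s
  let g' : (Finset ι → ℝ≥0∞) → ℝ≥0∞ := fun a => g fun i => ∑ s with i ∈ s, a s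
  have hg' : Measurable g' := hg.comp (by fun_prop)
  have hgm : ∀ m : Measure E, g (fun i => m (B i)) = g' fun s => m (atom B s) := fun m => by
    simp only [g', ← measure_eq_sum_atom hB]
  have hm (s : Finset ι) : Measurable fun ω => p ω (atom B s) := hp.measurable _ (hA s)
  calc ∫⁻ ω, p ω (B j) * g (fun i => p ω (B i)) ∂P
      = ∑ s with j ∈ s, ∫⁻ ω, p ω (atom B s) * g' (fun s => p ω (atom B s)) ∂P := by
        rw [← lintegral_finsetSum (f := fun s ω => p ω (atom B s) * g' fun s => p ω (atom B s)) _
          fun s _ => (hm s).mul (hg'.comp (measurable_pi_lambda _ hm))]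
        refine lintegral_congr fun ω => ?_
        rw [hgm, measure_eq_sum_atom hB (p ω) j, Finset.sum_mul]
    _ = ∑ s with j ∈ s, ∫⁻ x in atom B s,
          ∫⁻ ω, g (fun i => (p ω + Measure.dirac x) (B i)) ∂P ∂μ := by
        refine Finset.sum_congr rfl fun s hs => ?_
        have hjs : j ∈ s := by simpa using hs
        rw [hp.lintegral_mul_disjoint hA (pairwise_disjoint_atom B) s
          ((measure_mono (atom_subset hjs)).trans_lt hj) hg', mul_comm, ← setLIntegral_const]
        refine setLIntegral_congr_fun (hA s) fun x hx => lintegral_congr fun ω => ?_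
        rw [hgm]
        congr 1
        ext t
        rw [Measure.add_apply, Measure.dirac_apply' _ (hA t)]
        by_cases hts : t = s
        · subst hts; simp [hx]
        · simp [hts, Set.disjoint_left.1 (pairwise_disjoint_atom B (Ne.symm hts)) hx]
    _ = _ := by
        conv_rhs => rw [← biUnion_atom B j]
        rw [lintegral_biUnion_finset (fun s _ t _ hst => pairwise_disjoint_atom B hst)
          fun s _ => hA s]

/-- The evaluation cylinders, a `π`-system that generates the `σ`-algebra on `Measure E`. -/
def measureCylinders (E : Type*) [MeasurableSpace E] : Set (Set (Measure E)) :=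
  {C | ∃ (n : ℕ) (B : Fin n → Set E) (V : Fin n → Set ℝ≥0∞), (∀ i, MeasurableSet (B i)) ∧
    (∀ i, MeasurableSet (V i)) ∧ C = {m | ∀ i, m (B i) ∈ V i}}

theorem measurableSet_measureCylinder [Countable ι] {B : ι → Set E} {V : ι → Set ℝ≥0∞}
    (hB : ∀ i, MeasurableSet (B i)) (hV : ∀ i, MeasurableSet (V i)) :
    MeasurableSet {m : Measure E | ∀ i, m (B i) ∈ V i} :=
  measurableSet_setOfPred.2 (Measurable.forall fun i =>
    measurableSet_setOfPred.1 ((Measure.measurable_coe (hB i)) (hV i)))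

theorem isPiSystem_measureCylinders : IsPiSystem (measureCylinders E) := by
  rintro _ ⟨n, B, V, hB, hV, rfl⟩ _ ⟨n', B', V', hB', hV', rfl⟩ -
  refine ⟨n + n', Fin.append B B', Fin.append V V', ?_, ?_, ?_⟩
  · exact fun i => Fin.addCases (by simpa using hB) (by simpa using hB') i
  · exact fun i => Fin.addCases (by simpa using hV) (by simpa using hV') i
  · ext m
    constructor
    · rintro ⟨h, h'⟩ i
      exact Fin.addCases (by simpa using h) (by simpa using h') i
    · exact fun h => ⟨fun i => by simpa using h (Fin.castAdd n' i),
        fun i => by simpa using h (Fin.natAdd n i)⟩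

theorem generateFrom_measureCylinders :
    (inferInstance : MeasurableSpace (Measure E)) =
      MeasurableSpace.generateFrom (measureCylinders E) := by
  apply le_antisymm
  · refine iSup₂_le fun B hB => ?_
    rintro _ ⟨V, hV, rfl⟩
    refine MeasurableSpace.measurableSet_generateFrom
      ⟨1, fun _ => B, fun _ => V, fun _ => hB, fun _ => hV, ?_⟩
    ext m
    simp
  · refine MeasurableSpace.generateFrom_le ?_
    rintro _ ⟨n, B, V, hB, hV, rfl⟩
    exact measurableSet_measureCylinder hB hV

/-- The Mecke formula, as an identity of measures: the law of `p` with density `p(D)` is the law of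
`p + δ_x`, with `x` drawn from the restriction of `μ` to `D`, independently of `p`. -/
theorem IsPoissonRandomMeasure.withDensity_eq_map (hp : IsPoissonRandomMeasure p μ P)
    [IsProbabilityMeasure P] {D : Set E} (hD : MeasurableSet D) (hμD : μ D < ∞) :
    (P.map p).withDensity (fun m => m D)
      = (P.prod (μ.restrict D)).map fun z => p z.1 + Measure.dirac z.2 := by
  classical
  have hpm := hp.measurable_measure
  have : IsFiniteMeasure (μ.restrict D) := ⟨by simpa using hμD⟩
  have key : ∀ C ∈ measureCylinders E, (P.map p).withDensity (fun m => m D) C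
      = (P.prod (μ.restrict D)).map (fun z => p z.1 + Measure.dirac z.2) C := by
    rintro _ ⟨n, B, V, hB, hV, rfl⟩
    have hC : MeasurableSet {m : Measure E | ∀ i, m (B i) ∈ V i} :=
      measurableSet_measureCylinder hB hV
    let B' : Option (Fin n) → Set E := fun i => i.elim D B
    have hB' : ∀ i, MeasurableSet (B' i) := fun i => by cases i <;> simp [B', hD, hB]
    have hW : MeasurableSet {a : Option (Fin n) → ℝ≥0∞ | ∀ i : Fin n, a (some i) ∈ V i} :=
      measurableSet_setOfPred.2 (Measurable.forall fun i =>
        measurableSet_setOfPred.1 ((measurable_pi_apply (some i)) (hV i)))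
    have h := hp.lintegral_mul_finite hB' none hμD (g := Set.indicator
      {a | ∀ i : Fin n, a (some i) ∈ V i} 1) (measurable_one.indicator hW)
    rw [withDensity_apply _ hC, ← lintegral_indicator hC, lintegral_map
      ((Measure.measurable_coe hD).indicator hC) hpm,
      Measure.map_apply hp.measurable_add_dirac hC,
      Measure.prod_apply_symm (hp.measurable_add_dirac hC)]
    refine Eq.trans (lintegral_congr fun ω => ?_) (h.trans (lintegral_congr fun x => ?_))
    · by_cases hω : ∀ i, p ω (B i) ∈ V i
      · rw [Set.indicator_of_mem (by exact hω), Set.indicator_of_mem (by exact hω)]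
        exact (mul_one _).symm
      · rw [Set.indicator_of_notMem (by exact hω), Set.indicator_of_notMem (by exact hω), mul_zero]
    · rw [← lintegral_indicator_one]
      · refine lintegral_congr fun ω => ?_
        by_cases hω : ∀ i, (p ω + Measure.dirac x) (B i) ∈ V i
        · rw [Set.indicator_of_mem (by exact hω), Set.indicator_of_mem (by exact hω)]; rfl
        · rw [Set.indicator_of_notMem (by exact hω), Set.indicator_of_notMem (by exact hω)]
      · exact measurable_prodMk_right (hp.measurable_add_dirac hC)
  have huniv := key Set.univ ⟨0, fun i => i.elim0, fun i => i.elim0, fun i => i.elim0,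
    fun i => i.elim0, by ext; simp⟩
  have : IsFiniteMeasure ((P.map p).withDensity fun m => m D) := ⟨by
    rw [huniv, Measure.map_apply hp.measurable_add_dirac .univ]
    exact measure_lt_top _ _⟩
  exact ext_of_generate_finite _ generateFrom_measureCylinders isPiSystem_measureCylinders key huniv

theorem IsPoissonRandomMeasure.lintegral_mecke (hp : IsPoissonRandomMeasure p μ P)
    [IsProbabilityMeasure P] {D : Set E} (hD : MeasurableSet D) (hμD : μ D < ∞)
    {g : Measure E → ℝ≥0∞} (hg : Measurable g) :
    ∫⁻ ω, p ω D * g (p ω) ∂P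
      = ∫⁻ z, g (p z.1 + Measure.dirac z.2) ∂(P.prod (μ.restrict D)) := by
  rw [← lintegral_map hg hp.measurable_add_dirac, ← hp.withDensity_eq_map hD hμD,
    lintegral_withDensity_eq_lintegral_mul _ (Measure.measurable_coe hD) hg,
    lintegral_map (by exact (Measure.measurable_coe hD).mul hg) hp.measurable_measure]
  rfl

theorem IsPoissonRandomMeasure.lintegral_measure (hp : IsPoissonRandomMeasure p μ P)
    [IsProbabilityMeasure P] {D : Set E} (hD : MeasurableSet D) (hμD : μ D < ∞) :
    ∫⁻ ω, p ω D ∂P = μ D := by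
  have : IsFiniteMeasure (μ.restrict D) := ⟨by simpa using hμD⟩
  have h := hp.lintegral_mecke hD hμD (g := fun _ => 1) measurable_const
  rw [lintegral_const, ← Set.univ_prod_univ, Measure.prod_prod] at h
  simpa using h

theorem IsPoissonRandomMeasure.ae_lt_top (hp : IsPoissonRandomMeasure p μ P)
    [IsProbabilityMeasure P] {D : Set E} (hD : MeasurableSet D) (hμD : μ D < ∞) :
    ∀ᵐ ω ∂P, p ω D < ∞ :=
  MeasureTheory.ae_lt_top (hp.measurable D hD) (by rw [hp.lintegral_measure hD hμD]; exact hμD.ne)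

/-- A property that holds for almost every realization of `p` still holds after adding a point, for
almost every added point. -/
theorem IsPoissonRandomMeasure.ae_add_dirac (hp : IsPoissonRandomMeasure p μ P)
    [IsProbabilityMeasure P] [SigmaFinite μ] {q : Measure E → Prop}
    (hq : MeasurableSet {m | q m}) (h : ∀ᵐ ω ∂P, q (p ω)) :
    ∀ᵐ z ∂(P.prod μ), q (p z.1 + Measure.dirac z.2) := by
  have hD (n : ℕ) : ∀ᵐ z ∂(P.prod (μ.restrict (spanningSets μ n))),
      q (p z.1 + Measure.dirac z.2) := by
    refine ae_of_ae_map hp.measurable_add_dirac.aemeasurable ?_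
    rw [← hp.withDensity_eq_map (measurableSet_spanningSets μ n) (measure_spanningSets_lt_top μ n)]
    refine (withDensity_absolutelyContinuous _ _).ae_le ?_
    exact (ae_map_iff hp.measurable_measure.aemeasurable hq).2 h
  have h2 : ∀ n, ∀ᵐ z ∂((P.prod μ).restrict (Set.univ ×ˢ spanningSets μ n)),
      q (p z.1 + Measure.dirac z.2) := fun n => by
    rw [← Measure.prod_restrict, Measure.restrict_univ]
    exact hD n
  rw [← ae_restrict_iUnion_iff] at h2
  simpa [← Set.prod_iUnion, iUnion_spanningSets] using h2

end Mecke

/-! ### Integration by parts against simple integrands -/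

theorem integrable_inner_of_memLp_two {𝕜 α H : Type*} [RCLike 𝕜] [MeasurableSpace α]
    [NormedAddCommGroup H] [InnerProductSpace 𝕜 H] {P : Measure α} {f g : α → H}
    (hf : MemLp f 2 P) (hg : MemLp g 2 P) :
    Integrable (fun x => inner 𝕜 (f x) (g x)) P := by
  refine (L2.integrable_inner (𝕜 := 𝕜) (hf.toLp f) (hg.toLp g)).congr ?_
  filter_upwards [hf.coeFn_toLp, hg.coeFn_toLp] with x h1 h2
  rw [h1, h2]

section IntegrationByParts

variable {𝕜 Ω E H : Type*} [RCLike 𝕜] [MeasurableSpace Ω] [MeasurableSpace E]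
  [NormedAddCommGroup H] [InnerProductSpace 𝕜 H]
  {p : Ω → Measure E} {μ : Measure E} {P : Measure Ω}

/-- The Mecke formula for the compensated measure and functionals with values in `𝕜`. -/
theorem IsPoissonRandomMeasure.integral_compensated_mul [IsProbabilityMeasure P]
    (hp : IsPoissonRandomMeasure p μ P)
    {D : Set E} (hD : MeasurableSet D) (hμD : μ D < ∞) {U : Measure E → 𝕜}
    (hU : StronglyMeasurable U) (h1 : Integrable (fun ω => U (p ω)) P)
    (h2 : Integrable (fun z => U (p z.1 + Measure.dirac z.2)) (P.prod (μ.restrict D))) :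
    ∫ ω, (compensated p μ D ω : 𝕜) * U (p ω) ∂P
      = ∫ z, (U (p z.1 + Measure.dirac z.2) - U (p z.1)) ∂(P.prod (μ.restrict D)) := by
  have : IsFiniteMeasure (μ.restrict D) := ⟨by simpa using hμD⟩
  have hpm := hp.measurable_measure
  have hDm := Measure.measurable_coe hD
  have hfin : ∀ᵐ m ∂(P.map p), m D < ∞ :=
    (ae_map_iff hpm.aemeasurable (measurableSet_lt hDm measurable_const)).2 (hp.ae_lt_top hD hμD)
  have hw : Integrable U ((P.map p).withDensity fun m => m D) := by
    rw [hp.withDensity_eq_map hD hμD]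
    exact (integrable_map_measure hU.aestronglyMeasurable
      hp.measurable_add_dirac.aemeasurable).2 h2
  have hi : Integrable (fun ω => (p ω D).toReal • U (p ω)) P :=
    (integrable_map_measure (hDm.ennreal_toReal.aestronglyMeasurable.smul
      hU.aestronglyMeasurable) hpm.aemeasurable).1
      ((integrable_withDensity_iff_integrable_smul' hDm hfin).1 hw)
  have he : ∫ ω, (p ω D).toReal • U (p ω) ∂P
      = ∫ z, U (p z.1 + Measure.dirac z.2) ∂(P.prod (μ.restrict D)) := by
    rw [← integral_map hp.measurable_add_dirac.aemeasurable hU.aestronglyMeasurable,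
      ← hp.withDensity_eq_map hD hμD, integral_withDensity_eq_integral_toReal_smul hDm hfin,
      integral_map hpm.aemeasurable]
    exact hDm.ennreal_toReal.aestronglyMeasurable.smul hU.aestronglyMeasurable
  rw [integral_sub h2 (h1.comp_fst _), ← he, integral_fun_fst (fun ω => U (p ω))]
  simp only [Measure.real, Measure.restrict_apply_univ]
  rw [← integral_smul, ← integral_sub hi (by exact h1.smul (μ D).toReal)]
  refine integral_congr_ae (.of_forall fun ω => ?_)
  simp only [compensated, RCLike.real_smul_eq_coe_mul]
  push_cast
  ring

/-- The data of an integrand `φ(p) 1_D`: the set `R` plays the role of the future, `D` is a part of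
it of finite measure, and `φ` is a functional of the past, one that does not change when a point
of `R` is added to `p`. -/
structure IsSimpleIntegrand (p : Ω → Measure E) (μ : Measure E) (P : Measure Ω) (R D : Set E)
    (φ : Measure E → H) : Prop where
  measurableSet : MeasurableSet D
  measure_lt_top : μ D < ∞
  subset : D ⊆ R
  stronglyMeasurable : StronglyMeasurable φ
  add_dirac : ∀ m, ∀ x ∈ R, φ (m + Measure.dirac x) = φ m
  memLp : MemLp (fun ω => φ (p ω)) 2 P

namespace IsSimpleIntegrand

variable {R D R' D' : Set E} {φ φ' : Measure E → H}

/-- The integrand `φ(p) 1_D`. -/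
def process (p : Ω → Measure E) (D : Set E) (φ : Measure E → H) (z : Ω × E) : H :=
  D.indicator (fun _ => φ (p z.1)) z.2

/-- The stochastic integral `q(D) φ(p)` of `φ(p) 1_D`. -/
def integral (𝕜 : Type*) [RCLike 𝕜] [InnerProductSpace 𝕜 H] (p : Ω → Measure E) (μ : Measure E)
    (D : Set E) (φ : Measure E → H) (ω : Ω) : H :=
  (compensated p μ D ω : 𝕜) • φ (p ω)

theorem memLp_fst (h : IsSimpleIntegrand p μ P R D φ) :
    MemLp (fun z : Ω × E => φ (p z.1)) 2 (P.prod (μ.restrict D)) := by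
  have : IsFiniteMeasure (μ.restrict D) := ⟨by simpa using h.measure_lt_top⟩
  exact h.memLp.comp_fst _

theorem process_eq_indicator {Ω : Type*} (p : Ω → Measure E) (D : Set E) (φ : Measure E → H) :
    process p D φ = (Set.univ ×ˢ D).indicator fun z => φ (p z.1) := by
  ext z
  by_cases hz : z.2 ∈ D <;> simp [process, hz]

theorem memLp_process [SFinite P] [SFinite μ] (h : IsSimpleIntegrand p μ P R D φ) :
    MemLp (process p D φ) 2 (P.prod μ) := by
  rw [process_eq_indicator, memLp_indicator_iff_restrict (.prod .univ h.measurableSet),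
    ← Measure.prod_restrict, Measure.restrict_univ]
  exact h.memLp_fst

/-- The stochastic integral of a simple integrand is square-integrable. The second moment of
`p(D) φ(p)` is finite by two applications of the Mecke formula. -/
theorem memLp_integral [IsProbabilityMeasure P] (hp : IsPoissonRandomMeasure p μ P)
    (h : IsSimpleIntegrand p μ P R D φ) :
    MemLp (integral 𝕜 p μ D φ) 2 P := by
  have : IsFiniteMeasure (μ.restrict D) := ⟨by simpa using h.measure_lt_top⟩
  have hD := h.measurableSet
  have hpm := hp.measurable_measure
  have hφ : StronglyMeasurable fun ω => φ (p ω) := h.stronglyMeasurable.comp_measurable hpm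
  have hN : Measurable fun m => ‖φ m‖ₑ ^ 2 := h.stronglyMeasurable.enorm.pow_const 2
  have hDm := Measure.measurable_coe hD
  have hsq : ∫⁻ ω, ‖φ (p ω)‖ₑ ^ 2 ∂P < ∞ := by
    have := lintegral_rpow_enorm_lt_top_of_eLpNorm_lt_top two_ne_zero (by simp) h.memLp.2
    simpa using this
  -- On `D` the functional `φ` ignores the added point, while `m D` grows by one.
  have hadd : ∀ᵐ z ∂(P.prod (μ.restrict D)),
      φ (p z.1 + Measure.dirac z.2) = φ (p z.1) ∧ (p z.1 + Measure.dirac z.2) D = p z.1 D + 1 := by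
    have hz : ∀ᵐ z ∂(P.prod (μ.restrict D)), z.2 ∈ D :=
      Measure.quasiMeasurePreserving_snd.ae (ae_restrict_mem hD)
    filter_upwards [hz] with z hz
    refine ⟨h.add_dirac _ _ (h.subset hz), ?_⟩
    simp [Measure.dirac_apply' _ hD, hz]
  have hfst (g : Ω → ℝ≥0∞) (hg : Measurable g) :
      ∫⁻ z, g z.1 ∂(P.prod (μ.restrict D)) = μ D * ∫⁻ ω, g ω ∂P := by
    rw [lintegral_prod _ (by fun_prop)]
    simp [lintegral_const, lintegral_mul_const _ hg, mul_comm]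
  have hNp : Measurable fun ω => ‖φ (p ω)‖ₑ ^ 2 := hN.comp hpm
  have hDp := hp.measurable D hD
  have h1 : ∫⁻ ω, p ω D * ‖φ (p ω)‖ₑ ^ 2 ∂P < ∞ := by
    rw [hp.lintegral_mecke hD h.measure_lt_top hN]
    rw [lintegral_congr_ae (g := fun z => ‖φ (p z.1)‖ₑ ^ 2)
      (by filter_upwards [hadd] with z hz; rw [hz.1]), hfst _ hNp]
    exact ENNReal.mul_lt_top h.measure_lt_top hsq
  have h2 : ∫⁻ ω, p ω D * (p ω D * ‖φ (p ω)‖ₑ ^ 2) ∂P < ∞ := by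
    rw [hp.lintegral_mecke hD h.measure_lt_top (g := fun m => m D * ‖φ m‖ₑ ^ 2) (hDm.mul hN)]
    rw [lintegral_congr_ae (g := fun z => (p z.1 D + 1) * ‖φ (p z.1)‖ₑ ^ 2)
      (by filter_upwards [hadd] with z hz; rw [hz.1, hz.2]),
      hfst (fun ω => (p ω D + 1) * ‖φ (p ω)‖ₑ ^ 2) ((hDp.add_const 1).mul hNp)]
    refine ENNReal.mul_lt_top h.measure_lt_top ?_
    simp only [add_mul, one_mul]
    rw [lintegral_add_right _ hNp]
    exact ENNReal.add_lt_top.2 ⟨h1, hsq⟩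
  have h3 : MemLp (fun ω => ((p ω D).toReal : 𝕜) • φ (p ω)) 2 P := by
    refine ⟨((RCLike.measurable_ofReal.comp hDp.ennreal_toReal).stronglyMeasurable.smul
      hφ).aestronglyMeasurable, ?_⟩
    refine (eLpNorm_lt_top_iff_lintegral_rpow_enorm_lt_top two_ne_zero (by simp)).2 ?_
    refine lt_of_le_of_lt (lintegral_mono fun ω => ?_) h2
    have hle : ‖((p ω D).toReal : 𝕜)‖ₑ ≤ p ω D := by
      rw [← ofReal_norm, RCLike.norm_of_nonneg ENNReal.toReal_nonneg]
      exact ENNReal.ofReal_toReal_le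
    simp only [ENNReal.toReal_ofNat, ENNReal.rpow_ofNat, enorm_smul]
    rw [mul_pow, ← mul_assoc, pow_two]
    gcongr
  convert h3.sub (h.memLp.const_smul ((μ D).toReal : 𝕜)) using 1
  ext ω
  simp [integral, compensated, sub_smul]

/-- Integration by parts: the stochastic integral of a simple integrand is its divergence, tested
against any square-integrable functional `F` of `p` for which the difference operator is
square-integrable on `Ω × D`. -/
theorem integral_inner_integral [IsProbabilityMeasure P] [SFinite μ]
    (hp : IsPoissonRandomMeasure p μ P)
    (h : IsSimpleIntegrand p μ P R D φ)
    {F : Measure E → H} (hF : StronglyMeasurable F) (hF2 : MemLp (fun ω => F (p ω)) 2 P)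
    (hDF : MemLp (fun z => F (p z.1 + Measure.dirac z.2) - F (p z.1)) 2
      (P.prod (μ.restrict D))) :
    ∫ ω, inner 𝕜 (F (p ω)) (integral 𝕜 p μ D φ ω) ∂P
      = ∫ z, inner 𝕜 (F (p z.1 + Measure.dirac z.2) - F (p z.1)) (process p D φ z)
          ∂(P.prod μ) := by
  have hD := h.measurableSet
  have : IsFiniteMeasure (μ.restrict D) := ⟨by simpa using h.measure_lt_top⟩
  have hφ := h.memLp_fst
  have hadd : ∀ᵐ z ∂(P.prod (μ.restrict D)), φ (p z.1 + Measure.dirac z.2) = φ (p z.1) := by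
    have hz : ∀ᵐ z ∂(P.prod (μ.restrict D)), z.2 ∈ D :=
      Measure.quasiMeasurePreserving_snd.ae (ae_restrict_mem hD)
    filter_upwards [hz] with z hz
    exact h.add_dirac _ _ (h.subset hz)
  have hFadd : MemLp (fun z => F (p z.1 + Measure.dirac z.2)) 2 (P.prod (μ.restrict D)) := by
    refine (hDF.add (hF2.comp_fst (μ.restrict D))).congr_norm ?_ (.of_forall fun z => by simp)
    exact (hF.comp_measurable hp.measurable_add_dirac).aestronglyMeasurable
  have h1 : Integrable (fun ω => inner 𝕜 (F (p ω)) (φ (p ω))) P :=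
    integrable_inner_of_memLp_two hF2 h.memLp
  have h2 : Integrable (fun z : Ω × E => inner 𝕜 (F (p z.1 + Measure.dirac z.2))
      (φ (p z.1 + Measure.dirac z.2))) (P.prod (μ.restrict D)) := by
    refine (integrable_inner_of_memLp_two (𝕜 := 𝕜) hFadd hφ).congr ?_
    filter_upwards [hadd] with z hz
    rw [hz]
  have key := hp.integral_compensated_mul hD h.measure_lt_top
    (U := fun m => inner 𝕜 (F m) (φ m)) (hF.inner h.stronglyMeasurable) h1 h2
  simp only [integral, inner_smul_right]
  rw [key, process_eq_indicator]
  have hind : (fun z : Ω × E => inner 𝕜 (F (p z.1 + Measure.dirac z.2) - F (p z.1))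
      ((Set.univ ×ˢ D).indicator (fun z => φ (p z.1)) z))
      = (Set.univ ×ˢ D).indicator fun z =>
        inner 𝕜 (F (p z.1 + Measure.dirac z.2) - F (p z.1)) (φ (p z.1)) := by
    ext z
    by_cases hz : z ∈ (Set.univ : Set Ω) ×ˢ D
    · simp only [Set.indicator_of_mem hz]
    · simp only [Set.indicator_of_notMem hz, inner_zero_right]
  rw [hind, integral_indicator (.prod .univ hD), ← Measure.prod_restrict, Measure.restrict_univ]
  refine integral_congr_ae ?_
  filter_upwards [hadd] with z hz
  rw [hz, inner_sub_left]

/-- The Itô isometry for two simple integrands, the second of which has the smaller future. -/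
theorem integral_inner_integral_integral [IsProbabilityMeasure P] [SigmaFinite μ]
    (hp : IsPoissonRandomMeasure p μ P)
    (h : IsSimpleIntegrand p μ P R D φ) (h' : IsSimpleIntegrand p μ P R' D' φ') (hR : R' ⊆ R) :
    ∫ ω, inner 𝕜 (integral 𝕜 p μ D φ ω) (integral 𝕜 p μ D' φ' ω) ∂P
      = ∫ z, inner 𝕜 (process p D φ z) (process p D' φ' z) ∂(P.prod μ) := by
  have hD := h.measurableSet
  -- The integral `q(D) φ(p)` as a functional of `p`, whose difference operator is `φ(p) 1_D`.
  let F : Measure E → H := fun m => (((m D).toReal - (μ D).toReal : ℝ) : 𝕜) • φ m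
  have hF : StronglyMeasurable F :=
    (RCLike.measurable_ofReal.comp ((Measure.measurable_coe hD).ennreal_toReal.sub_const
      _)).stronglyMeasurable.smul h.stronglyMeasurable
  have hdiff : ∀ᵐ z ∂(P.prod μ), z.2 ∈ D' →
      F (p z.1 + Measure.dirac z.2) - F (p z.1) = process p D φ z := by
    have hfin : ∀ᵐ z ∂(P.prod μ), p z.1 D < ∞ :=
      Measure.quasiMeasurePreserving_fst.ae (hp.ae_lt_top hD h.measure_lt_top)
    filter_upwards [hfin] with z hz hz'
    simp only [F, h.add_dirac _ _ (hR (h'.subset hz')), ← sub_smul, process, Measure.add_apply]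
    by_cases hzD : z.2 ∈ D
    · simp [Measure.dirac_apply' _ hD, hzD, ENNReal.toReal_add hz.ne]
    · simp [Measure.dirac_apply' _ hD, hzD]
  have hdiff' : ∀ᵐ z ∂(P.prod (μ.restrict D')),
      F (p z.1 + Measure.dirac z.2) - F (p z.1) = process p D φ z := by
    rw [← Measure.restrict_univ (μ := P), Measure.prod_restrict,
      ae_restrict_iff' (.prod .univ h'.measurableSet)]
    filter_upwards [hdiff] with z hz hz'
    exact hz hz'.2
  have hL : MemLp (process p D φ) 2 (P.prod (μ.restrict D')) := by
    rw [← Measure.restrict_univ (μ := P), Measure.prod_restrict]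
    exact h.memLp_process.restrict _
  refine (h'.integral_inner_integral hp hF (h.memLp_integral hp)
    ((memLp_congr_ae hdiff').2 hL)).trans (integral_congr_ae ?_)
  filter_upwards [hdiff] with z hz
  by_cases hzD : z.2 ∈ D'
  · rw [hz hzD]
  · simp [process, hzD]

end IsSimpleIntegrand

end IntegrationByParts

/-! ### The Malliavin derivative as a difference operator -/

section Difference

variable {𝕜 Ω E H : Type*} [RCLike 𝕜] [MeasurableSpace Ω] [MeasurableSpace E]
  [NormedAddCommGroup H] [InnerProductSpace 𝕜 H]
  {p : Ω → Measure E} {μ : Measure E} {P : Measure Ω}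

/-- With `id` for the random measure, `toRV` is the functional on measures that `F` evaluates at
`p`. -/
theorem Cylinder.stronglyMeasurable_toRV (F : Cylinder μ H) :
    StronglyMeasurable (F.toRV 𝕜 (id : Measure E → Measure E)) := by
  have hc : Measurable (F.counts (id : Measure E → Measure E)) :=
    measurable_pi_lambda _ fun m =>
      Nat.measurable_floor.comp (Measure.measurable_coe (F.measurableSet_B m)).ennreal_toReal
  refine Finset.stronglyMeasurable_fun_sum _ fun i _ => StronglyMeasurable.smul_const ?_ _
  exact (RCLike.measurable_ofReal.comp (Measurable.of_discrete.comp hc)).stronglyMeasurable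

theorem Cylinder.counts_add_dirac {H : Type*} (F : Cylinder μ H) {m : Measure E}
    (hm : ∀ k, m (F.B k) < ∞) {x : E} {k : Fin F.M} (hx : x ∈ F.B k) :
    F.counts (id : Measure E → Measure E) (m + Measure.dirac x)
      = F.counts (id : Measure E → Measure E) m + Pi.single k 1 := by
  ext l
  simp only [counts, id, Measure.add_apply, Pi.add_apply,
    Measure.dirac_apply' _ (F.measurableSet_B l)]
  by_cases hl : l = k
  · subst hl
    simp [hx, ENNReal.toReal_add (hm l).ne, Nat.floor_add_one]
  · simp [hl, Set.disjoint_left.1 (F.disjoint_B (Ne.symm hl)) hx]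

/-- The derivative of a cylindrical random variable, seen as a functional of `p`, is its difference
under adding a point to `p`. -/
theorem Cylinder.derivative_eq {Ω : Type*} {p : Ω → Measure E} (F : Cylinder μ H) {z : Ω × E}
    (hz : ∀ k, p z.1 (F.B k) < ∞) :
    F.derivative 𝕜 p z = F.toRV 𝕜 (id : Measure E → Measure E) (p z.1 + Measure.dirac z.2)
      - F.toRV 𝕜 (id : Measure E → Measure E) (p z.1) := by
  have hcounts : F.counts p z.1 = F.counts (id : Measure E → Measure E) (p z.1) := rfl
  rw [toRV, toRV, ← Finset.sum_sub_distrib, derivative]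
  refine Finset.sum_congr rfl fun i _ => ?_
  by_cases hx : ∃ k, z.2 ∈ F.B k
  · obtain ⟨k, hk⟩ := hx
    rw [Finset.sum_eq_single k, Set.indicator_of_mem hk, F.counts_add_dirac hz hk, hcounts,
      ← sub_smul]
    · push_cast; rfl
    · exact fun l _ hl => Set.indicator_of_notMem
        (Set.disjoint_left.1 (F.disjoint_B (Ne.symm hl)) hk) _
    · simp
  · push Not at hx
    have : F.counts (id : Measure E → Measure E) (p z.1 + Measure.dirac z.2)
        = F.counts (id : Measure E → Measure E) (p z.1) := by
      ext l
      simp [counts, Measure.dirac_apply' _ (F.measurableSet_B l), hx l]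
    rw [this, sub_self]
    exact Finset.sum_eq_zero fun k _ => Set.indicator_of_notMem (hx k) _

/-- `X` is the random variable `F(p)`, for a functional `F` of the random measure, and `Y` is its
difference `F(p + δ_x) - F(p)`. -/
structure IsDifferencePair (p : Ω → Measure E) (μ : Measure E) (P : Measure Ω)
    (F : Measure E → H) (X : Lp H 2 P) (Y : Lp H 2 (P.prod μ)) : Prop where
  stronglyMeasurable : StronglyMeasurable F
  fst_ae_eq : X =ᵐ[P] fun ω => F (p ω)
  snd_ae_eq : Y =ᵐ[P.prod μ] fun z => F (p z.1 + Measure.dirac z.2) - F (p z.1)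

theorem IsDifferencePair.zero :
    IsDifferencePair p μ P (0 : Measure E → H) (0 : Lp H 2 P) (0 : Lp H 2 (P.prod μ)) where
  stronglyMeasurable := stronglyMeasurable_zero
  fst_ae_eq := Lp.coeFn_zero _ _ _
  snd_ae_eq := (Lp.coeFn_zero _ _ _).trans (.of_forall fun z => by simp)

theorem IsDifferencePair.add {F F' : Measure E → H} {X X' : Lp H 2 P} {Y Y' : Lp H 2 (P.prod μ)}
    (h : IsDifferencePair p μ P F X Y) (h' : IsDifferencePair p μ P F' X' Y') :
    IsDifferencePair p μ P (F + F') (X + X') (Y + Y') where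
  stronglyMeasurable := h.stronglyMeasurable.add h'.stronglyMeasurable
  fst_ae_eq := (Lp.coeFn_add _ _).trans (h.fst_ae_eq.add h'.fst_ae_eq)
  snd_ae_eq := ((Lp.coeFn_add _ _).trans (h.snd_ae_eq.add h'.snd_ae_eq)).trans
    (.of_forall fun z => by simp only [Pi.add_apply]; abel)

theorem IsDifferencePair.smul {F : Measure E → H} {X : Lp H 2 P} {Y : Lp H 2 (P.prod μ)}
    (h : IsDifferencePair p μ P F X Y) (c : 𝕜) :
    IsDifferencePair p μ P (c • F) (c • X) (c • Y) where
  stronglyMeasurable := h.stronglyMeasurable.const_smul c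
  fst_ae_eq := (Lp.coeFn_smul _ _).trans (h.fst_ae_eq.const_smul c)
  snd_ae_eq := ((Lp.coeFn_smul _ _).trans (h.snd_ae_eq.const_smul c)).trans
    (.of_forall fun z => by simp only [Pi.smul_apply, smul_sub])

/-- The difference operator is closable: by the Mecke formula, functionals that tend to zero
almost surely still do so after adding a point. -/
theorem IsPoissonRandomMeasure.difference_closable (hp : IsPoissonRandomMeasure p μ P)
    [IsProbabilityMeasure P] [SigmaFinite μ] {F : ℕ → Measure E → H} {X : ℕ → Lp H 2 P}
    {Y : ℕ → Lp H 2 (P.prod μ)} {Z : Lp H 2 (P.prod μ)}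
    (h : ∀ n, IsDifferencePair p μ P (F n) (X n) (Y n))
    (hX : Tendsto X atTop (𝓝 0)) (hY : Tendsto Y atTop (𝓝 Z)) : Z = 0 := by
  obtain ⟨ns, hns, hX'⟩ := (tendstoInMeasure_of_tendsto_Lp hX).exists_seq_tendsto_ae
  obtain ⟨ms, hms, hY'⟩ := (tendstoInMeasure_of_tendsto_Lp
    (hY.comp hns.tendsto_atTop)).exists_seq_tendsto_ae
  have h0 : ∀ᵐ ω ∂P, Tendsto (fun i => ‖F (ns i) (p ω)‖) atTop (𝓝 0) := by
    filter_upwards [hX', Lp.coeFn_zero H 2 P, ae_all_iff.2 fun n => (h n).fst_ae_eq]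
      with ω h1 h2 h3
    simp only [h3, h2, Pi.zero_apply] at h1
    exact tendsto_zero_iff_norm_tendsto_zero.1 h1
  have h1 := hp.ae_add_dirac (q := fun m => Tendsto (fun i => ‖F (ns i) m‖) atTop (𝓝 0))
    (measurableSet_tendsto _ fun i => (h _).stronglyMeasurable.norm.measurable) h0
  have h2 : ∀ᵐ z ∂(P.prod μ), Tendsto (fun i => ‖F (ns i) (p z.1)‖) atTop (𝓝 0) :=
    Measure.quasiMeasurePreserving_fst.ae h0
  refine Lp.ext ?_
  filter_upwards [h1, h2, hY', Lp.coeFn_zero H 2 (P.prod μ),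
    ae_all_iff.2 fun n => (h n).snd_ae_eq] with z h1 h2 h3 h4 h5
  rw [h4]
  simp only [Function.comp_apply, h5] at h3
  have h6 := ((tendsto_zero_iff_norm_tendsto_zero.2 h1).sub
    (tendsto_zero_iff_norm_tendsto_zero.2 h2)).comp hms.tendsto_atTop
  rw [sub_zero] at h6
  exact tendsto_nhds_unique h3 h6

/-- The duality between the difference operator and the stochastic integral of a simple
integrand. -/
theorem IsDifferencePair.inner_eq (hp : IsPoissonRandomMeasure p μ P)
    [IsProbabilityMeasure P] [SigmaFinite μ] {F φ : Measure E → H} {R D : Set E}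
    {X I : Lp H 2 P} {Y Φ : Lp H 2 (P.prod μ)}
    (h : IsDifferencePair p μ P F X Y) (hφ : IsSimpleIntegrand p μ P R D φ)
    (hΦ : Φ =ᵐ[P.prod μ] IsSimpleIntegrand.process p D φ)
    (hI : I =ᵐ[P] IsSimpleIntegrand.integral 𝕜 p μ D φ) :
    inner 𝕜 Y Φ = inner 𝕜 X I := by
  have h1 : MemLp (fun ω => F (p ω)) 2 P := (memLp_congr_ae h.fst_ae_eq).1 (Lp.memLp X)
  have h2 : MemLp (fun z => F (p z.1 + Measure.dirac z.2) - F (p z.1)) 2 (P.prod μ) :=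
    (memLp_congr_ae h.snd_ae_eq).1 (Lp.memLp Y)
  have h3 : MemLp (fun z => F (p z.1 + Measure.dirac z.2) - F (p z.1)) 2
      (P.prod (μ.restrict D)) := by
    rw [← Measure.restrict_univ (μ := P), Measure.prod_restrict]
    exact h2.restrict _
  rw [L2.inner_def, L2.inner_def]
  refine Eq.trans (integral_congr_ae ?_)
    ((hφ.integral_inner_integral hp h.stronglyMeasurable h1 h3).symm.trans (integral_congr_ae ?_))
  · filter_upwards [h.snd_ae_eq, hΦ] with z hz hz'
    rw [hz, hz']
  · filter_upwards [h.fst_ae_eq, hI] with z hz hz'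
    rw [hz, hz']

end Difference

section Graph

variable {𝕜 Ω S H : Type*} [RCLike 𝕜] [MeasurableSpace Ω] [MeasurableSpace S]
  [NormedAddCommGroup H] [InnerProductSpace 𝕜 H] {T : ℝ}
  {ν : Measure S} {p : Ω → Measure (S × Time T)} {P : Measure Ω}

instance isFiniteMeasure_time (T : ℝ) :
    IsFiniteMeasure (Measure.comap (Subtype.val : Time T → ℝ) volume) := ⟨by
  rw [(MeasurableEmbedding.subtype_coe measurableSet_Icc).comap_apply,
    Set.image_univ, Subtype.range_coe]
  exact measure_Icc_lt_top⟩

theorem exists_isDifferencePair [IsProbabilityMeasure P] [SigmaFinite ν]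
    (hp : IsPoissonRandomMeasure p (intensity ν T) P)
    {z : L2Omega P H × L2Product P ν T H} (hz : z ∈ cylindricalGraph 𝕜 P ν p H) :
    ∃ F, IsDifferencePair p (intensity ν T) P F z.1 z.2 := by
  induction hz using Submodule.span_induction with
  | mem z hz =>
    obtain ⟨F, h1, h2⟩ := hz
    refine ⟨_, F.stronglyMeasurable_toRV (𝕜 := 𝕜), h1, h2.trans ?_⟩
    have hfin : ∀ᵐ z ∂(P.prod (intensity ν T)), ∀ k, p z.1 (F.B k) < ∞ :=
      ae_all_iff.2 fun k => Measure.quasiMeasurePreserving_fst.ae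
        (hp.ae_lt_top (F.measurableSet_B k) (F.measure_B_lt_top k))
    filter_upwards [hfin] with z hz
    exact F.derivative_eq hz
  | zero => exact ⟨_, .zero⟩
  | add x y _ _ hx hy => exact ⟨_, hx.choose_spec.add hy.choose_spec⟩
  | smul c x _ hx => exact ⟨_, hx.choose_spec.smul c⟩

theorem cylindricalGraph_closable [IsProbabilityMeasure P] [SigmaFinite ν]
    (hp : IsPoissonRandomMeasure p (intensity ν T) P)
    (z : L2Omega P H × L2Product P ν T H)
    (hz : z ∈ (cylindricalGraph 𝕜 P ν p H).topologicalClosure) (h0 : z.1 = 0) : z.2 = 0 := by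
  obtain ⟨u, hu, hlim⟩ := mem_closure_iff_seq_limit.1 hz
  choose F hF using fun n => exists_isDifferencePair hp (hu n)
  refine hp.difference_closable hF ?_ ((continuous_snd.tendsto z).comp hlim)
  rw [← h0]
  exact (continuous_fst.tendsto z).comp hlim

end Graph

/-! ### Adapted coefficients as functionals of the past -/

section Filtration

variable {Ω S H : Type*} {mΩ : MeasurableSpace Ω} [MeasurableSpace S] {T : ℝ}
  {ν : Measure S} {p : Ω → Measure (S × Time T)} {P : Measure Ω} {𝓕 : Filtration (Time T) mΩ}

/-- The part `S × (s, T]` of the space that lies after the time `s`. -/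
def future (S : Type*) {T : ℝ} (s : Time T) : Set (S × Time T) := {x | s < x.2}

theorem measurableSet_future (s : Time T) : MeasurableSet (future S s) :=
  measurable_snd measurableSet_Ioi

theorem future_antitone {S : Type*} {s t : Time T} (h : s ≤ t) : future S t ⊆ future S s :=
  fun _ hx => h.trans_lt hx

theorem generatedSigma_le_comap (s : Time T) : generatedSigma p ν s ≤
    MeasurableSpace.comap (fun ω => (p ω).restrict (future S s)ᶜ) inferInstance := by
  refine MeasurableSpace.generateFrom_le ?_
  rintro _ ⟨r, u, A, D, -, hus, hA, -, hD, rfl⟩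
  have hm : MeasurableSet (A ×ˢ Set.Ioc r u) := hA.prod measurableSet_Ioc
  refine ⟨{m | (m (A ×ˢ Set.Ioc r u)).toReal - (intensity ν T (A ×ˢ Set.Ioc r u)).toReal ∈ D},
    ((Measure.measurable_coe hm).ennreal_toReal.sub_const _) hD, ?_⟩
  have hsub : A ×ˢ Set.Ioc r u ∩ (future S s)ᶜ = A ×ˢ Set.Ioc r u :=
    Set.inter_eq_left.2 fun x hx => not_lt.2 (hx.2.2.trans hus)
  ext ω
  simp only [Set.mem_preimage, Set.mem_ofPred_eq, compensated, Measure.restrict_apply hm, hsub]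

/-- A square-integrable `𝓕 s`-measurable random variable is almost surely a functional of `p` that
does not see the points of the future. -/
theorem IsGeneratedFiltration.exists_functional [IsProbabilityMeasure P] [NormedAddCommGroup H]
    [NormedSpace ℝ H] [CompleteSpace H] (h𝓕 : IsGeneratedFiltration P p ν 𝓕) {s : Time T}
    {φ : Ω → H} (hφ : StronglyMeasurable[𝓕 s] φ) (hφ2 : MemLp φ 2 P) :
    ∃ ψ : Measure (S × Time T) → H, StronglyMeasurable ψ ∧
      (∀ m, ∀ x ∈ future S s, ψ (m + Measure.dirac x) = ψ m) ∧ φ =ᵐ[P] fun ω => ψ (p ω) := by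
  have hG : generatedSigma p ν s ≤ mΩ := (h𝓕.generated_le s).trans (𝓕.le s)
  have hint : Integrable φ P := hφ2.integrable one_le_two
  -- Sets of `𝓕 s` agree up to null sets with generated sets, so the conditional expectations agree.
  have heq : P[φ|generatedSigma p ν s] =ᵐ[P] P[φ|𝓕 s] := by
    refine ae_eq_condExp_of_forall_setIntegral_eq (𝓕.le s) hint
      (fun _ _ _ => integrable_condExp.integrableOn) (fun A hA _ => ?_)
      (stronglyMeasurable_condExp.mono (h𝓕.generated_le s)).aestronglyMeasurable
    obtain ⟨A', hA', hAA'⟩ := h𝓕.le_augmented s A hA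
    rw [setIntegral_congr_set hAA', setIntegral_congr_set hAA', setIntegral_condExp hG hint hA']
  rw [condExp_of_stronglyMeasurable (𝓕.le s) hφ hint] at heq
  have hm : StronglyMeasurable[generatedSigma p ν s] (P[φ|generatedSigma p ν s]) :=
    stronglyMeasurable_condExp
  obtain ⟨ψ, hψ, hψe⟩ := (hm.mono (generatedSigma_le_comap s)).exists_eq_measurable_comp
  have hc := (measurableSet_future (S := S) s).compl
  refine ⟨fun m => ψ (m.restrict (future S s)ᶜ),
    hψ.comp_measurable (Measure.measurable_of_measurable_coe _ fun B hB => ?_),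
    fun m x hx => ?_, ?_⟩
  · simpa only [Measure.restrict_apply hB] using Measure.measurable_coe (hB.inter hc)
  · refine congrArg ψ ?_
    ext B hB
    rw [Measure.restrict_apply hB, Measure.restrict_apply hB, Measure.add_apply,
      Measure.dirac_apply' _ (hB.inter hc), Set.indicator_of_notMem (fun h => h.2 hx), add_zero]
  · refine heq.symm.trans (.of_forall fun ω => ?_)
    exact congrFun hψe ω

end Filtration

/-! ### The Itô isometry and the duality for sums of simple integrands -/

section SimpleGraph

variable {𝕜 Ω S H : Type*} [RCLike 𝕜] {mΩ : MeasurableSpace Ω} [MeasurableSpace S]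
  [NormedAddCommGroup H] [InnerProductSpace 𝕜 H] {T : ℝ}
  {ν : Measure S} {p : Ω → Measure (S × Time T)} {P : Measure Ω} {𝓕 : Filtration (Time T) mΩ}

/-- The graph of the stochastic integral on linear combinations of simple integrands. -/
def simpleGraph (𝕜 : Type*) [RCLike 𝕜] (P : Measure Ω) (ν : Measure S)
    (p : Ω → Measure (S × Time T)) (H : Type*) [NormedAddCommGroup H] [InnerProductSpace 𝕜 H] :
    Submodule 𝕜 (L2Product P ν T H × L2Omega P H) :=
  Submodule.span 𝕜 {z | ∃ (s : Time T) (D : Set (S × Time T)) (φ : Measure (S × Time T) → H),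
    IsSimpleIntegrand p (intensity ν T) P (future S s) D φ ∧
    z.1 =ᵐ[P.prod (intensity ν T)] IsSimpleIntegrand.process p D φ ∧
    z.2 =ᵐ[P] IsSimpleIntegrand.integral 𝕜 p (intensity ν T) D φ}

/-- The Itô isometry. Of two simple integrands, neither coefficient sees the future of the one that
starts later, so that the integration by parts applies with this future. -/
theorem simpleGraph_isometry [IsProbabilityMeasure P] [SigmaFinite ν]
    (hp : IsPoissonRandomMeasure p (intensity ν T) P) {z z' : L2Product P ν T H × L2Omega P H}
    (hz : z ∈ simpleGraph 𝕜 P ν p H) (hz' : z' ∈ simpleGraph 𝕜 P ν p H) :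
    inner 𝕜 z.2 z'.2 = inner 𝕜 z.1 z'.1 := by
  have key {s s' : Time T} {D D' : Set (S × Time T)} {φ φ' : Measure (S × Time T) → H}
      {z z' : L2Product P ν T H × L2Omega P H} (hs : s ≤ s')
      (h : IsSimpleIntegrand p (intensity ν T) P (future S s) D φ)
      (h' : IsSimpleIntegrand p (intensity ν T) P (future S s') D' φ')
      (h1 : z.1 =ᵐ[P.prod (intensity ν T)] IsSimpleIntegrand.process p D φ)
      (h2 : z.2 =ᵐ[P] IsSimpleIntegrand.integral 𝕜 p (intensity ν T) D φ)
      (h1' : z'.1 =ᵐ[P.prod (intensity ν T)] IsSimpleIntegrand.process p D' φ')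
      (h2' : z'.2 =ᵐ[P] IsSimpleIntegrand.integral 𝕜 p (intensity ν T) D' φ') :
      inner 𝕜 z.2 z'.2 = inner 𝕜 z.1 z'.1 := by
    rw [L2.inner_def, L2.inner_def]
    refine Eq.trans (integral_congr_ae ?_)
      ((h.integral_inner_integral_integral hp h' (future_antitone hs)).trans
        (integral_congr_ae ?_))
    · filter_upwards [h2, h2'] with ω h h'
      rw [h, h']
    · filter_upwards [h1, h1'] with ω h h'
      rw [h, h']
  induction hz, hz' using Submodule.span_induction₂ with
  | mem_mem z z' hz hz' =>
    obtain ⟨s, D, φ, h, h1, h2⟩ := hz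
    obtain ⟨s', D', φ', h', h1', h2'⟩ := hz'
    rcases le_total s s' with hs | hs
    · exact key hs h h' h1 h2 h1' h2'
    · rw [← inner_conj_symm z.1, ← inner_conj_symm z.2, key hs h' h h1' h2' h1 h2]
  | zero_left => simp
  | zero_right => simp
  | add_left x y z _ _ _ hx hy => simp [inner_add_left, hx, hy]
  | add_right x y z _ _ _ hx hy => simp [inner_add_right, hx, hy]
  | smul_left c x y _ _ hx => simp [inner_smul_left, hx]
  | smul_right c x y _ _ hx => simp [inner_smul_right, hx]

theorem inner_cylindricalGraph_simpleGraph [IsProbabilityMeasure P] [SigmaFinite ν]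
    (hp : IsPoissonRandomMeasure p (intensity ν T) P) {w : L2Omega P H × L2Product P ν T H}
    {z : L2Product P ν T H × L2Omega P H} (hw : w ∈ cylindricalGraph 𝕜 P ν p H)
    (hz : z ∈ simpleGraph 𝕜 P ν p H) : inner 𝕜 w.2 z.1 = inner 𝕜 w.1 z.2 := by
  obtain ⟨F, hF⟩ := exists_isDifferencePair hp hw
  induction hz using Submodule.span_induction with
  | mem z hz =>
    obtain ⟨s, D, φ, h, h1, h2⟩ := hz
    exact hF.inner_eq hp h h1 h2
  | zero => simp
  | add x y _ _ hx hy => simp [inner_add_right, hx, hy]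
  | smul c x _ hx => simp [inner_smul_right, hx]

theorem intensity_prod_Ioc_lt_top {A : Set S} (hA : ν A < ∞) (B : Set (Time T)) :
    intensity ν T (A ×ˢ B) < ∞ := by
  rw [intensity, Measure.prod_prod]
  exact ENNReal.mul_lt_top hA (measure_lt_top _ _)

/-- The increments of `q(t, A)` are almost surely the values of `q`; this uses that the values of
`p` involved are finite, `∞ - ∞` being a junk value. -/
theorem noise_sub_noise [IsProbabilityMeasure P] [SigmaFinite ν]
    (hp : IsPoissonRandomMeasure p (intensity ν T) P) {A : Set S} (hA : MeasurableSet A)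
    (hνA : ν A < ∞) {s t : Time T} (hst : s ≤ t) :
    ∀ᵐ ω ∂P, ElementaryIntegrand.noise p ν t A ω - ElementaryIntegrand.noise p ν s A ω
      = compensated p (intensity ν T) (A ×ˢ Set.Ioc s t) ω := by
  have hpos : MeasurableSet {u : Time T | 0 < (u : ℝ)} := measurable_subtype_coe measurableSet_Ioi
  have hm (u : Time T) : MeasurableSet (A ×ˢ {v : Time T | 0 < (v : ℝ) ∧ v ≤ u}) :=
    hA.prod (hpos.inter measurableSet_Iic)
  have hI : MeasurableSet (A ×ˢ Set.Ioc s t) := hA.prod measurableSet_Ioc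
  have hadd (m : Measure (S × Time T)) : m (A ×ˢ {v : Time T | 0 < (v : ℝ) ∧ v ≤ t})
      = m (A ×ˢ {v : Time T | 0 < (v : ℝ) ∧ v ≤ s}) + m (A ×ˢ Set.Ioc s t) := by
    rw [← measure_union _ hI, ← Set.prod_union]
    · congr 2
      ext v
      constructor
      · rintro ⟨h0, h⟩
        exact (le_or_gt v s).imp (fun hv => ⟨h0, hv⟩) fun hv => ⟨hv, h⟩
      · rintro (⟨h0, h⟩ | ⟨h0, h⟩)
        · exact ⟨h0, h.trans hst⟩
        · exact ⟨lt_of_le_of_lt s.2.1 h0, h⟩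
    · exact Set.disjoint_left.2 fun x hx hx' => not_lt.2 hx.2.2 hx'.2.1
  filter_upwards [hp.ae_lt_top (hm s) (intensity_prod_Ioc_lt_top hνA _),
    hp.ae_lt_top hI (intensity_prod_Ioc_lt_top hνA _)] with ω h1 h2
  simp only [ElementaryIntegrand.noise, compensated]
  rw [hadd, hadd (intensity ν T), ENNReal.toReal_add h1.ne h2.ne,
    ENNReal.toReal_add (intensity_prod_Ioc_lt_top hνA _).ne (intensity_prod_Ioc_lt_top hνA _).ne]
  ring

/-- The process of an elementary integrand and its integral up to time `T` are square-integrable,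
and agree with sums of simple integrands and of their stochastic integrals. -/
theorem exists_mem_simpleGraph [IsProbabilityMeasure P] [SigmaFinite ν] [NormedSpace ℝ H]
    [CompleteSpace H] (hT : 0 ≤ T) (hp : IsPoissonRandomMeasure p (intensity ν T) P)
    (h𝓕 : IsGeneratedFiltration P p ν 𝓕) (e : ElementaryIntegrand P ν 𝓕 H) :
    ∃ z ∈ simpleGraph 𝕜 P ν p H, z.1 =ᵐ[P.prod (intensity ν T)] e.toIntegrand ∧
      z.2 =ᵐ[P] e.integral 𝕜 p ⟨T, hT, le_rfl⟩ := by
  choose ψ hψm hψ hψe using fun n m =>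
    h𝓕.exists_functional (e.coeff_measurable n m) (e.coeff_memLp n m)
  let D : (n : Fin e.N) → Fin (e.M n) → Set (S × Time T) := fun n m =>
    e.A n m ×ˢ Set.Ioc (e.t n.castSucc) (e.t n.succ)
  have hs : ∀ n m, IsSimpleIntegrand p (intensity ν T) P (future S (e.t n.castSucc)) (D n m)
      (ψ n m) := fun n m =>
    { measurableSet := (e.measurableSet_A n m).prod measurableSet_Ioc
      measure_lt_top := intensity_prod_Ioc_lt_top (e.measure_A_lt_top n m) _
      subset := fun x hx => hx.2.1
      stronglyMeasurable := hψm n m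
      add_dirac := hψ n m
      memLp := (memLp_congr_ae (hψe n m)).1 (e.coeff_memLp n m) }
  let X' : (n : Fin e.N) → Fin (e.M n) → L2Product P ν T H := fun n m =>
    (hs n m).memLp_process.toLp (IsSimpleIntegrand.process p (D n m) (ψ n m))
  let I' : (n : Fin e.N) → Fin (e.M n) → L2Omega P H := fun n m =>
    ((hs n m).memLp_integral hp).toLp
      (IsSimpleIntegrand.integral 𝕜 p (intensity ν T) (D n m) (ψ n m))
  have hX : (∑ n, ∑ m, X' n m : L2Product P ν T H) =ᵐ[P.prod (intensity ν T)] e.toIntegrand := by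
    have hsum : ∀ᵐ z ∂(P.prod (intensity ν T)), ∀ n, (∑ m, X' n m) z = ∑ m, X' n m z :=
      ae_all_iff.2 fun n => Lp.coeFn_fun_finsetSum _ _
    have hco : ∀ᵐ z ∂(P.prod (intensity ν T)), ∀ n m, e.coeff n m z.1 = ψ n m (p z.1) :=
      ae_all_iff.2 fun n => ae_all_iff.2 fun m =>
        Measure.quasiMeasurePreserving_fst.ae (hψe n m)
    have hpr : ∀ᵐ z ∂(P.prod (intensity ν T)), ∀ n m,
        X' n m z = IsSimpleIntegrand.process p (D n m) (ψ n m) z :=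
      ae_all_iff.2 fun n => ae_all_iff.2 fun m => MemLp.coeFn_toLp _
    filter_upwards [Lp.coeFn_fun_finsetSum Finset.univ fun n => ∑ m, X' n m, hsum, hco, hpr]
      with z h1 h2 h3 h4
    rw [h1]
    simp only [h2, h4, ElementaryIntegrand.toIntegrand, h3]
    rfl
  have hI : (∑ n, ∑ m, I' n m : L2Omega P H) =ᵐ[P] e.integral 𝕜 p ⟨T, hT, le_rfl⟩ := by
    have hsum : ∀ᵐ ω ∂P, ∀ n, (∑ m, I' n m) ω = ∑ m, I' n m ω :=
      ae_all_iff.2 fun n => Lp.coeFn_fun_finsetSum _ _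
    have hco : ∀ᵐ ω ∂P, ∀ n m, e.coeff n m ω = ψ n m (p ω) :=
      ae_all_iff.2 fun n => ae_all_iff.2 fun m => hψe n m
    have hno : ∀ᵐ ω ∂P, ∀ n m, ElementaryIntegrand.noise p ν (e.t n.succ) (e.A n m) ω
        - ElementaryIntegrand.noise p ν (e.t n.castSucc) (e.A n m) ω
          = compensated p (intensity ν T) (D n m) ω :=
      ae_all_iff.2 fun n => ae_all_iff.2 fun m => noise_sub_noise hp (e.measurableSet_A n m)
        (e.measure_A_lt_top n m) (e.t_strictMono n.castSucc_lt_succ).le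
    have hin : ∀ᵐ ω ∂P, ∀ n m, I' n m ω
        = IsSimpleIntegrand.integral 𝕜 p (intensity ν T) (D n m) (ψ n m) ω :=
      ae_all_iff.2 fun n => ae_all_iff.2 fun m => MemLp.coeFn_toLp _
    have hmin (u : Time T) : min u ⟨T, hT, le_rfl⟩ = u := min_eq_left u.2.2
    filter_upwards [Lp.coeFn_fun_finsetSum Finset.univ fun n => ∑ m, I' n m, hsum, hco, hno, hin]
      with ω h1 h2 h3 h4 h5
    rw [h1]
    simp only [h2, h5, ElementaryIntegrand.integral, h3, hmin, h4]
    rfl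
  refine ⟨∑ n, ∑ m, (X' n m, I' n m), Submodule.sum_mem _ fun n _ => Submodule.sum_mem _ fun m _ =>
    Submodule.subset_span ⟨_, _, _, hs n m, (hs n m).memLp_process.coeFn_toLp,
      ((hs n m).memLp_integral hp).coeFn_toLp⟩, ?_, ?_⟩
  · simpa only [Prod.fst_sum] using hX
  · simpa only [Prod.snd_sum] using hI

theorem elementaryGraph_le_simpleGraph [IsProbabilityMeasure P] [SigmaFinite ν] [NormedSpace ℝ H]
    [CompleteSpace H] (hT : 0 ≤ T) (hp : IsPoissonRandomMeasure p (intensity ν T) P)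
    (h𝓕 : IsGeneratedFiltration P p ν 𝓕) :
    elementaryGraph 𝕜 P ν p 𝓕 H ⟨T, hT, le_rfl⟩ ≤ simpleGraph 𝕜 P ν p H := by
  refine Submodule.span_le.2 ?_
  rintro z ⟨e, h1, h2⟩
  obtain ⟨z', hz', h1', h2'⟩ := exists_mem_simpleGraph (𝕜 := 𝕜) hT hp h𝓕 e
  have h : z = z' := Prod.ext (Lp.ext (h1.trans h1'.symm)) (Lp.ext (h2.trans h2'.symm))
  exact h ▸ hz'

end SimpleGraph

/-! ### Density of elementary integrands -/

theorem setIntegral_eq_zero_of_isPiSystem {α H : Type*} {m m₀ : MeasurableSpace α}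
    {μ : Measure α} [NormedAddCommGroup H] [NormedSpace ℝ H] [CompleteSpace H] (hm : m ≤ m₀)
    {C : Set (Set α)} (hC : m = MeasurableSpace.generateFrom C) (hpi : IsPiSystem C)
    {f : α → H} (hf : Integrable f μ) (huniv : ∫ x, f x ∂μ = 0)
    (h : ∀ s ∈ C, ∫ x in s, f x ∂μ = 0) {s : Set α} (hs : MeasurableSet[m] s) :
    ∫ x in s, f x ∂μ = 0 := by
  induction s, hs using MeasurableSpace.induction_on_inter hC hpi with
  | empty => simp
  | basic t ht => exact h t ht
  | compl t ht hind =>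
    have := integral_add_compl (hm _ ht) hf
    rwa [hind, huniv, zero_add] at this
  | iUnion g hd hg hind =>
    rw [integral_iUnion (fun i => hm _ (hg i)) hd hf.integrableOn]
    simp [hind]

section Elementary

variable {𝕜 Ω S H : Type*} [RCLike 𝕜] {mΩ : MeasurableSpace Ω} [MeasurableSpace S]
  [NormedAddCommGroup H] [InnerProductSpace 𝕜 H] {T : ℝ}
  {ν : Measure S} {p : Ω → Measure (S × Time T)} {P : Measure Ω} {𝓕 : Filtration (Time T) mΩ}

theorem predictableSigma_le : predictableSigma S 𝓕 ≤
    (inferInstance : MeasurableSpace (Ω × (S × Time T))) := by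
  refine MeasurableSpace.generateFrom_le ?_
  rintro _ (⟨s, t, F, A, -, hF, hA, rfl⟩ | ⟨s, F, A, -, hF, hA, rfl⟩)
  · exact (𝓕.le s _ hF).prod (hA.prod measurableSet_Ioc)
  · exact (𝓕.le s _ hF).prod (hA.prod (measurableSet_singleton s))

theorem isPiSystem_predictable : IsPiSystem
    ({C | ∃ (s t : Time T) (F : Set Ω) (A : Set S), s < t ∧ MeasurableSet[𝓕 s] F ∧
        MeasurableSet A ∧ C = F ×ˢ (A ×ˢ Set.Ioc s t)} ∪
     {C | ∃ (s : Time T) (F : Set Ω) (A : Set S), (s : ℝ) = 0 ∧ MeasurableSet[𝓕 s] F ∧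
        MeasurableSet A ∧ C = F ×ˢ (A ×ˢ {s})}) := by
  rintro _ (⟨s, t, F, A, hst, hF, hA, rfl⟩ | ⟨s, F, A, hs, hF, hA, rfl⟩) _
    (⟨s', t', F', A', hst', hF', hA', rfl⟩ | ⟨s', F', A', hs', hF', hA', rfl⟩) ⟨z, hz, hz'⟩
  · refine Or.inl ⟨max s s', min t t', F ∩ F', A ∩ A', ?_, ?_, hA.inter hA', ?_⟩
    · exact (max_lt hz.2.2.1 hz'.2.2.1).trans_le (le_min hz.2.2.2 hz'.2.2.2)
    · exact (𝓕.mono (le_max_left _ _) _ hF).inter (𝓕.mono (le_max_right _ _) _ hF')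
    · rw [Set.prod_inter_prod, Set.prod_inter_prod, Set.Ioc_inter_Ioc]
  · have h : s < z.2.2 := hz.2.2.1
    rw [show z.2.2 = s' from hz'.2.2, ← Subtype.coe_lt_coe, hs'] at h
    exact absurd h (not_lt.2 s.2.1)
  · have h : s' < z.2.2 := hz'.2.2.1
    rw [show z.2.2 = s from hz.2.2, ← Subtype.coe_lt_coe, hs] at h
    exact absurd h (not_lt.2 s'.2.1)
  · obtain rfl : s = s' := Subtype.ext (hs.trans hs'.symm)
    refine Or.inr ⟨s, F ∩ F', A ∩ A', hs, hF.inter hF', hA.inter hA', ?_⟩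
    rw [Set.prod_inter_prod, Set.prod_inter_prod, Set.inter_self]

/-- The integrand `φ 1_{(s, T] × A}` is elementary, for the partition `{0, s, T}`, or `{0, T}` if
`s = 0`. -/
theorem exists_elementaryIntegrand (hT : 0 ≤ T) {s : Time T} (hs : (s : ℝ) < T) {A : Set S}
    (hA : MeasurableSet A) (hνA : ν A < ∞) {φ : Ω → H} (hφ : StronglyMeasurable[𝓕 s] φ)
    (hφ2 : MemLp φ 2 P) :
    ∃ e : ElementaryIntegrand P ν 𝓕 H, ∀ z, e.toIntegrand z
      = (A ×ˢ Set.Ioc s ⟨T, hT, le_rfl⟩).indicator (fun _ => φ z.1) z.2 := by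
  rcases s.2.1.eq_or_lt with h0 | h0
  · refine ⟨
      { N := 1
        t := ![s, ⟨T, hT, le_rfl⟩]
        t_strictMono := ?_
        t_zero := h0.symm
        t_last := rfl
        M := fun _ => 1
        A := fun _ _ => A
        measurableSet_A := fun _ _ => hA
        measure_A_lt_top := fun _ _ => hνA
        disjoint_A := fun _ i j hij => absurd (Subsingleton.elim i j) hij
        coeff := fun _ _ => φ
        coeff_measurable := fun n _ => ?_
        coeff_memLp := fun _ _ => hφ2 }, fun z => ?_⟩
    · refine Fin.strictMono_iff_lt_succ.2 fun i => ?_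
      fin_cases i
      exact hs
    · fin_cases n
      exact hφ
    · simp [ElementaryIntegrand.toIntegrand]
  · refine ⟨
      { N := 2
        t := ![⟨0, le_rfl, hT⟩, s, ⟨T, hT, le_rfl⟩]
        t_strictMono := ?_
        t_zero := rfl
        t_last := rfl
        M := fun _ => 1
        A := fun _ _ => A
        measurableSet_A := fun _ _ => hA
        measure_A_lt_top := fun _ _ => hνA
        disjoint_A := fun _ i j hij => absurd (Subsingleton.elim i j) hij
        coeff := fun n _ => ![0, φ] n
        coeff_measurable := fun n _ => ?_
        coeff_memLp := fun n _ => ?_ }, fun z => ?_⟩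
    · refine Fin.strictMono_iff_lt_succ.2 fun i => ?_
      fin_cases i
      · exact h0
      · exact hs
    · fin_cases n
      · exact stronglyMeasurable_zero
      · exact hφ
    · fin_cases n
      · exact MemLp.zero
      · exact hφ2
    · simp [ElementaryIntegrand.toIntegrand, Fin.sum_univ_two]

variable [IsProbabilityMeasure P] [SigmaFinite ν] [NormedSpace ℝ H] [CompleteSpace H]

/-- A function orthogonal to the elementary integrands has integral zero over the predictable
rectangles that reach up to the time `T`. -/
theorem setIntegral_rectangle_eq_zero (hT : 0 ≤ T)
    (hp : IsPoissonRandomMeasure p (intensity ν T) P) (h𝓕 : IsGeneratedFiltration P p ν 𝓕)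
    {w : L2Product P ν T H}
    (hw : w ∈ ((elementaryGraph 𝕜 P ν p 𝓕 H ⟨T, hT, le_rfl⟩).map (LinearMap.fst 𝕜 _ _))ᗮ)
    (s : Time T) {F : Set Ω} (hF : MeasurableSet[𝓕 s] F) {A : Set S} (hA : MeasurableSet A)
    (hνA : ν A < ∞) :
    ∫ z in F ×ˢ (A ×ˢ Set.Ioc s ⟨T, hT, le_rfl⟩), w z ∂(P.prod (intensity ν T)) = 0 := by
  rcases s.2.2.eq_or_lt with hs | hs
  · have : s = ⟨T, hT, le_rfl⟩ := Subtype.ext hs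
    simp [this]
  have hC : MeasurableSet (F ×ˢ (A ×ˢ Set.Ioc s ⟨T, hT, le_rfl⟩)) :=
    (𝓕.le s _ hF).prod (hA.prod measurableSet_Ioc)
  have hμC : (P.prod (intensity ν T)) (F ×ˢ (A ×ˢ Set.Ioc s ⟨T, hT, le_rfl⟩)) ≠ ∞ := by
    rw [Measure.prod_prod]
    exact (ENNReal.mul_lt_top (measure_lt_top _ _) (intensity_prod_Ioc_lt_top hνA _)).ne
  refine ext_inner_left 𝕜 fun c => ?_
  obtain ⟨e, he⟩ := exists_elementaryIntegrand (P := P) (ν := ν) hT hs hA hνA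
    (φ := F.indicator fun _ => c) (stronglyMeasurable_const.indicator hF)
    ((memLp_const c).indicator (𝓕.le s _ hF))
  obtain ⟨z, -, hz1, hz2⟩ := exists_mem_simpleGraph (𝕜 := 𝕜) hT hp h𝓕 e
  have hz : z.1 = indicatorConstLp 2 hC hμC c := by
    refine Lp.ext ((hz1.trans (.of_forall fun x => ?_)).trans indicatorConstLp_coeFn.symm)
    rw [he]
    by_cases h1 : x.1 ∈ F <;>
      by_cases h2 : x.2 ∈ A ×ˢ Set.Ioc s (⟨T, hT, le_rfl⟩ : Time T) <;>
      simp only [Set.indicator, Set.mem_prod (s := F), h1, h2, and_self, and_true, and_false,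
        if_true, if_false]
  rw [← L2.inner_indicatorConstLp_eq_inner_setIntegral 𝕜 hC hμC, ← hz, inner_zero_right]
  exact (Submodule.mem_orthogonal _ _).1 hw _
    ⟨z, Submodule.subset_span ⟨e, hz1, hz2⟩, rfl⟩

theorem comap_volume_singleton (s : Time T) :
    Measure.comap (Subtype.val : Time T → ℝ) volume {s} = 0 := by
  rw [(MeasurableEmbedding.subtype_coe measurableSet_Icc).comap_apply]
  simp

/-- A function orthogonal to the elementary integrands has integral zero over all predictable sets
of finite measure. -/
theorem setIntegral_predictable_eq_zero (hT : 0 ≤ T)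
    (hp : IsPoissonRandomMeasure p (intensity ν T) P) (h𝓕 : IsGeneratedFiltration P p ν 𝓕)
    {w : L2Product P ν T H}
    (hw : w ∈ ((elementaryGraph 𝕜 P ν p 𝓕 H ⟨T, hT, le_rfl⟩).map (LinearMap.fst 𝕜 _ _))ᗮ)
    {C : Set (Ω × (S × Time T))} (hC : MeasurableSet[predictableSigma S 𝓕] C)
    (hμC : P.prod (intensity ν T) C < ∞) :
    ∫ z in C, w z ∂(P.prod (intensity ν T)) = 0 := by
  have hint {B : Set (Ω × (S × Time T))} (hB : P.prod (intensity ν T) B < ∞) :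
      IntegrableOn w B (P.prod (intensity ν T)) :=
    integrableOn_Lp_of_measure_ne_top w fact_one_le_two_ennreal.elim hB.ne
  have hrect := setIntegral_rectangle_eq_zero hT hp h𝓕 hw
  have hnull (F : Set Ω) (A : Set S) (s : Time T) :
      P.prod (intensity ν T) (F ×ˢ (A ×ˢ {s})) = 0 := by
    rw [Measure.prod_prod, intensity, Measure.prod_prod, comap_volume_singleton]
    simp
  let R : ℕ → Set (Ω × (S × Time T)) := fun k =>
    Set.univ ×ˢ (spanningSets ν k ×ˢ Set.univ)
  have hR (k : ℕ) : MeasurableSet (R k) :=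
    .prod .univ ((measurableSet_spanningSets ν k).prod .univ)
  have hsets (F : Set Ω) {A : Set S} (hA : ν A < ∞) (B : Set (Time T)) :
      P.prod (intensity ν T) (F ×ˢ (A ×ˢ B)) < ∞ := by
    rw [Measure.prod_prod]
    exact ENNReal.mul_lt_top (measure_lt_top _ _) (intensity_prod_Ioc_lt_top hA _)
  have hRtop (k : ℕ) : P.prod (intensity ν T) (R k) < ∞ :=
    hsets _ (measure_spanningSets_lt_top ν k) _
  -- On each strip `R k` of finite measure the sets of integral zero form a Dynkin system.
  have hk (k : ℕ) : ∫ z in C ∩ R k, w z ∂(P.prod (intensity ν T)) = 0 := by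
    rw [← Measure.restrict_restrict (predictableSigma_le _ hC)]
    refine setIntegral_eq_zero_of_isPiSystem predictableSigma_le rfl isPiSystem_predictable
      (hint (hRtop k)) ?_ ?_ hC
    · let o : Time T := ⟨0, le_rfl, hT⟩
      have hsplit : R k = (Set.univ ×ˢ (spanningSets ν k ×ˢ Set.Ioc o ⟨T, hT, le_rfl⟩)) ∪
          (Set.univ ×ˢ (spanningSets ν k ×ˢ {o})) := by
        have hu : Set.Ioc o (⟨T, hT, le_rfl⟩ : Time T) ∪ {o} = Set.univ := by
          refine Set.eq_univ_of_forall fun u => ?_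
          rcases (show o ≤ u from u.2.1).lt_or_eq with h | h
          · exact Or.inl ⟨h, u.2.2⟩
          · exact Or.inr h.symm
        rw [← Set.prod_union, ← Set.prod_union, hu]
      rw [hsplit, setIntegral_congr_set (union_ae_eq_left_of_ae_eq_empty
        (ae_eq_empty.2 (hnull _ _ o)))]
      exact hrect o .univ (measurableSet_spanningSets ν k) (measure_spanningSets_lt_top ν k)
    · rintro _ (⟨s, t, F, A, hst, hF, hA, rfl⟩ | ⟨s, F, A, -, hF, hA, rfl⟩)
      · have hA' := hA.inter (measurableSet_spanningSets ν k)
        have hνA' : ν (A ∩ spanningSets ν k) < ∞ :=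
          (measure_mono Set.inter_subset_right).trans_lt (measure_spanningSets_lt_top ν k)
        have hsub : (F ×ˢ ((A ∩ spanningSets ν k) ×ˢ Set.Ioc t (⟨T, hT, le_rfl⟩ : Time T)))
            ⊆ F ×ˢ ((A ∩ spanningSets ν k) ×ˢ Set.Ioc s ⟨T, hT, le_rfl⟩) :=
          Set.prod_mono_right (Set.prod_mono_right (Set.Ioc_subset_Ioc_left hst.le))
        have hdiff : F ×ˢ (A ×ˢ Set.Ioc s t) ∩ R k =
            (F ×ˢ ((A ∩ spanningSets ν k) ×ˢ Set.Ioc s (⟨T, hT, le_rfl⟩ : Time T))) \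
            (F ×ˢ ((A ∩ spanningSets ν k) ×ˢ Set.Ioc t ⟨T, hT, le_rfl⟩)) := by
          ext z
          have hzT : z.2.2 ≤ (⟨T, hT, le_rfl⟩ : Time T) := z.2.2.2.2
          simp only [R, Set.mem_inter_iff, Set.mem_prod, Set.mem_Ioc, Set.mem_univ, Set.mem_sdiff,
            hzT, and_true, true_and, ← not_lt (a := t)]
          tauto
        rw [Measure.restrict_restrict ((𝓕.le s _ hF).prod (hA.prod measurableSet_Ioc)), hdiff,
          setIntegral_sdiff ((𝓕.le s _ hF).prod (hA'.prod measurableSet_Ioc))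
            (hint (hsets F hνA' _)) hsub, hrect s hF hA' hνA',
          hrect t (𝓕.mono hst.le _ hF) hA' hνA', sub_zero]
      · refine setIntegral_measure_zero _ ?_
        exact Measure.absolutelyContinuous_of_le Measure.restrict_le_self (hnull F A s)
  have hU : ⋃ k, C ∩ R k = C := by
    rw [← Set.inter_iUnion]
    refine Set.inter_eq_left.2 fun z _ => ?_
    have hz : z.2.1 ∈ ⋃ k, spanningSets ν k := by simp [iUnion_spanningSets]
    obtain ⟨k, hk⟩ := Set.mem_iUnion.1 hz
    exact Set.mem_iUnion.2 ⟨k, trivial, hk, trivial⟩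
  have hlim := tendsto_setIntegral_of_monotone (μ := P.prod (intensity ν T)) (f := w)
    (s := fun k => C ∩ R k) (fun k => (predictableSigma_le _ hC).inter (hR k))
    (fun i j hij => Set.inter_subset_inter_right _ (Set.prod_mono_right
      (Set.prod_mono_left (monotone_spanningSets ν hij)))) (by rw [hU]; exact hint hμC)
  simp only [hk, hU] at hlim
  exact tendsto_nhds_unique hlim tendsto_const_nhds

/-- Elementary integrands are dense among the predictable square-integrable ones. -/
theorem predictableL2_le_closure (hT : 0 ≤ T)
    (hp : IsPoissonRandomMeasure p (intensity ν T) P) (h𝓕 : IsGeneratedFiltration P p ν 𝓕) :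
    predictableL2 𝕜 P ν 𝓕 H ≤ ((elementaryGraph 𝕜 P ν p 𝓕 H ⟨T, hT, le_rfl⟩).map
      (LinearMap.fst 𝕜 _ _)).topologicalClosure := by
  intro Φ hΦ
  rw [← Submodule.orthogonal_orthogonal_eq_closure]
  set K := ((elementaryGraph 𝕜 P ν p 𝓕 H ⟨T, hT, le_rfl⟩).map (LinearMap.fst 𝕜 _ _))ᗮ with hK
  refine Lp.induction_stronglyMeasurable predictableSigma_le (by simp) (fun f => f ∈ Kᗮ) ?_ ?_ ?_
    Φ hΦ
  · intro c C hC hμC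
    rw [Lp.simpleFunc.coe_indicatorConst, Submodule.mem_orthogonal']
    intro w hw
    rw [L2.inner_indicatorConstLp_eq_inner_setIntegral,
      setIntegral_predictable_eq_zero hT hp h𝓕 hw hC hμC, inner_zero_right]
  · intro f g hf hg _ _ _ h1 h2
    exact add_mem h1 h2
  · exact (Submodule.isClosed_orthogonal K).preimage continuous_subtype_val

end Elementary

/-! ### Density of the domain of the Malliavin derivative -/

section CylindricalDense

variable {𝕜 Ω E S H : Type*} [RCLike 𝕜] {mΩ : MeasurableSpace Ω} [MeasurableSpace E]
  [MeasurableSpace S] [NormedAddCommGroup H] [InnerProductSpace 𝕜 H] {T : ℝ}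
  {P : Measure Ω}

/-- Bounded cylindrical random variables lie in the domain of the Malliavin derivative: their
derivative is bounded and vanishes outside a set of finite measure. -/
theorem Cylinder.memLp_derivative {p : Ω → Measure E} {μ : Measure E} [IsProbabilityMeasure P]
    [SFinite μ] (hp : IsPoissonRandomMeasure p μ P) (F : Cylinder μ H) {K : ℝ}
    (hK : ∀ i k, |F.f i k| ≤ K) : MemLp (F.derivative 𝕜 p) 2 (P.prod μ) := by
  refine memLp_finsetSum _ fun i _ => memLp_finsetSum _ fun m _ => ?_
  have hm := F.measurableSet_B m
  have : IsFiniteMeasure (μ.restrict (F.B m)) := ⟨by simpa using F.measure_B_lt_top m⟩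
  have hc : Measurable (F.counts p) := measurable_pi_lambda _ fun m =>
    Nat.measurable_floor.comp (hp.measurable _ (F.measurableSet_B m)).ennreal_toReal
  let g : Ω × E → H := fun z =>
    ((F.f i (F.counts p z.1 + Pi.single m 1) - F.f i (F.counts p z.1) : ℝ) : 𝕜) • F.h i
  have hg : StronglyMeasurable g := by
    refine StronglyMeasurable.smul_const (RCLike.measurable_ofReal.comp ?_).stronglyMeasurable _
    exact (Measurable.of_discrete (f := fun k => F.f i (k + Pi.single m 1) - F.f i k)).comp
      (hc.comp measurable_fst)
  have heq : (fun z : Ω × E => (F.B m).indicator (fun _ => g z) z.2)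
      = (Set.univ ×ˢ F.B m).indicator g := by
    ext z
    by_cases hz : z.2 ∈ F.B m <;> simp [hz]
  change MemLp (fun z : Ω × E => (F.B m).indicator (fun _ => g z) z.2) 2 _
  rw [heq, memLp_indicator_iff_restrict (.prod .univ hm), ← Measure.prod_restrict,
    Measure.restrict_univ]
  refine MemLp.of_bound hg.aestronglyMeasurable ((K + K) * ‖F.h i‖) (.of_forall fun z => ?_)
  rw [norm_smul, RCLike.norm_ofReal]
  gcongr
  exact (abs_sub _ _).trans (add_le_add (hK _ _) (hK _ _))

/-- The events described by the numbers of points in finitely many sets of finite measure. -/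
def countEvents (p : Ω → Measure E) (μ : Measure E) : Set (Set Ω) :=
  {C | ∃ (n : ℕ) (B : Fin n → Set E) (V : Fin n → Set ℝ), (∀ i, MeasurableSet (B i)) ∧
    (∀ i, μ (B i) < ∞) ∧ (∀ i, MeasurableSet (V i)) ∧ C = {ω | ∀ i, (p ω (B i)).toReal ∈ V i}}

theorem isPiSystem_countEvents {Ω : Type*} (p : Ω → Measure E) (μ : Measure E) :
    IsPiSystem (countEvents p μ) := by
  rintro _ ⟨n, B, V, hB, hμB, hV, rfl⟩ _ ⟨n', B', V', hB', hμB', hV', rfl⟩ -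
  refine ⟨n + n', Fin.append B B', Fin.append V V', ?_, ?_, ?_, ?_⟩
  · exact fun i => Fin.addCases (by simpa using hB) (by simpa using hB') i
  · exact fun i => Fin.addCases (by simpa using hμB) (by simpa using hμB') i
  · exact fun i => Fin.addCases (by simpa using hV) (by simpa using hV') i
  · ext ω
    constructor
    · rintro ⟨h, h'⟩ i
      exact Fin.addCases (by simpa using h) (by simpa using h') i
    · exact fun h => ⟨fun i => by simpa using h (Fin.castAdd n' i),
        fun i => by simpa using h (Fin.natAdd n i)⟩

theorem measurableSet_countEvents {p : Ω → Measure E} {μ : Measure E}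
    (hp : IsPoissonRandomMeasure p μ P) {C : Set Ω} (hC : C ∈ countEvents p μ) :
    MeasurableSet C := by
  obtain ⟨n, B, V, hB, -, hV, rfl⟩ := hC
  exact measurableSet_setOfPred.2 (Measurable.forall fun i =>
    measurableSet_setOfPred.1 ((hp.measurable _ (hB i)).ennreal_toReal (hV i)))

/-- The indicator of an event of `countEvents` is a.s. a cylindrical random variable, based on the
atoms of the sets that describe the event. -/
theorem exists_cylinder_indicator {p : Ω → Measure E} {μ : Measure E} [IsProbabilityMeasure P]
    (hp : IsPoissonRandomMeasure p μ P) {C : Set Ω} (hC : C ∈ countEvents p μ) (c : H) :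
    ∃ F : Cylinder μ H, (∀ i k, |F.f i k| ≤ 1) ∧ F.toRV 𝕜 p =ᵐ[P] C.indicator fun _ => c := by
  classical
  obtain ⟨n, B, V, hB, hμB, -, rfl⟩ := hC
  let e := Fintype.equivFin (Finset (Fin n))
  let f : (Fin (Fintype.card (Finset (Fin n))) → ℕ) → ℝ := fun k =>
    if ∀ i, (∑ s with i ∈ s, (k (e s) : ℝ)) ∈ V i then 1 else 0
  let F : Cylinder μ H :=
    { M := Fintype.card (Finset (Fin n))
      n := 1
      B := fun m => atom B (e.symm m)
      measurableSet_B := fun m => measurableSet_atom hB _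
      measure_B_lt_top := fun m => measure_atom_lt_top hμB _
      disjoint_B := fun i j hij => pairwise_disjoint_atom B (e.symm.injective.ne hij)
      f := fun _ => f
      h := fun _ => c }
  refine ⟨F, fun _ k => ?_, ?_⟩
  · change |f k| ≤ 1
    by_cases h : ∀ i, (∑ s with i ∈ s, (k (e s) : ℝ)) ∈ V i <;> simp [f, h]
  · have hfin : ∀ᵐ ω ∂P, ∀ s, p ω (atom B s) < ∞ := ae_all_iff.2 fun s =>
      hp.ae_lt_top (measurableSet_atom hB s) (measure_atom_lt_top hμB s)
    filter_upwards [hfin] with ω hω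
    have hcount (s : Finset (Fin n)) : (F.counts p ω (e s) : ℝ) = (p ω (atom B s)).toReal := by
      obtain ⟨k, hk⟩ := hp.integer_valued ω _ (measurableSet_atom hB s)
      have hk' : k ≠ ⊤ := by
        rintro rfl
        simpa [hk] using hω s
      obtain ⟨k, rfl⟩ := ENat.ne_top_iff_exists.1 hk'
      simp [Cylinder.counts, F, hk]
    have hsum (i : Fin n) :
        ∑ s with i ∈ s, (F.counts p ω (e s) : ℝ) = (p ω (B i)).toReal := by
      rw [measure_eq_sum_atom hB, ENNReal.toReal_sum fun s _ => (hω s).ne]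
      exact Finset.sum_congr rfl fun s _ => hcount s
    have hF : F.toRV 𝕜 p ω = ((f (F.counts p ω) : ℝ) : 𝕜) • c := by
      simp [Cylinder.toRV, F]
    rw [hF]
    simp only [f, hsum]
    by_cases h : ∀ i, (p ω (B i)).toReal ∈ V i
    · rw [if_pos h, Set.indicator_of_mem (by exact h)]
      simp
    · rw [if_neg h, Set.indicator_of_notMem (by exact h)]
      simp

theorem generatedSigma_le_countEvents {p : Ω → Measure (S × Time T)} {ν : Measure S}
    (t : Time T) :
    generatedSigma p ν t ≤ MeasurableSpace.generateFrom (countEvents p (intensity ν T)) := by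
  refine MeasurableSpace.generateFrom_le ?_
  rintro _ ⟨r, u, A, D, -, -, hA, hνA, hD, rfl⟩
  refine MeasurableSpace.measurableSet_generateFrom ⟨1, fun _ => A ×ˢ Set.Ioc r u,
    fun _ => (fun x => x - (intensity ν T (A ×ˢ Set.Ioc r u)).toReal) ⁻¹' D,
    fun _ => hA.prod measurableSet_Ioc, fun _ => intensity_prod_Ioc_lt_top hνA _,
    fun _ => (measurable_id.sub_const _) hD, ?_⟩
  ext ω
  simp [compensated]

/-- The Malliavin derivative is densely defined. A vector orthogonal to all cylindrical indicators
has integral zero over the events of `countEvents`, hence over all events, since these are generated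
by `p` up to null sets. -/
theorem cylindricalGraph_dense [CompleteSpace H] [NormedSpace ℝ H] [IsProbabilityMeasure P]
    {ν : Measure S} [SigmaFinite ν] {p : Ω → Measure (S × Time T)}
    (hp : IsPoissonRandomMeasure p (intensity ν T) P) {t : Time T}
    (hΩ : mΩ ≤ augmented P (generatedSigma p ν t)) :
    Dense ((cylindricalGraph 𝕜 P ν p H).map (LinearMap.fst 𝕜 _ _) : Set (L2Omega P H)) := by
  rw [Submodule.dense_iff_topologicalClosure_eq_top, Submodule.topologicalClosure_eq_top_iff,
    Submodule.eq_bot_iff]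
  intro w hw
  have hint : Integrable w P := (Lp.memLp w).integrable one_le_two
  have hevent : ∀ C ∈ countEvents p (intensity ν T), ∫ ω in C, w ω ∂P = 0 := fun C hC => by
    have hCm := measurableSet_countEvents hp hC
    refine ext_inner_left 𝕜 fun c => ?_
    obtain ⟨F, hF, hFC⟩ := exists_cylinder_indicator (𝕜 := 𝕜) hp hC c
    rw [← L2.inner_indicatorConstLp_eq_inner_setIntegral 𝕜 hCm (measure_ne_top P C),
      inner_zero_right]
    have h1 := indicatorConstLp_coeFn (p := 2) (hs := hCm) (hμs := measure_ne_top P C) (c := c)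
    have hDF := F.memLp_derivative (𝕜 := 𝕜) hp hF
    exact (Submodule.mem_orthogonal _ _).1 hw _
      ⟨(indicatorConstLp 2 hCm (measure_ne_top P C) c, hDF.toLp _), Submodule.subset_span
        ⟨F, h1.trans hFC.symm, hDF.coeFn_toLp⟩, rfl⟩
  have hle : MeasurableSpace.generateFrom (countEvents p (intensity ν T)) ≤ mΩ :=
    MeasurableSpace.generateFrom_le fun C hC => measurableSet_countEvents hp hC
  have huniv : ∫ ω, w ω ∂P = 0 := by
    rw [← setIntegral_univ]
    exact hevent _ ⟨0, fun i => i.elim0, fun i => i.elim0, fun i => i.elim0, fun i => i.elim0,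
      fun i => i.elim0, by ext; simp⟩
  refine Lp.ext (.trans ?_ (Lp.coeFn_zero _ _ _).symm)
  refine hint.ae_eq_zero_of_forall_setIntegral_eq_zero fun A hA _ => ?_
  obtain ⟨A', hA', hAA'⟩ := hΩ A hA
  rw [setIntegral_congr_set hAA']
  exact setIntegral_eq_zero_of_isPiSystem hle rfl (isPiSystem_countEvents p _) hint huniv hevent
    (generatedSigma_le_countEvents t _ hA')

end CylindricalDense

/-! ### The Itô integral as a restriction of the divergence -/

section Closure

variable {𝕜 Ω S H : Type*} [RCLike 𝕜] {mΩ : MeasurableSpace Ω} [MeasurableSpace S]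
  [NormedAddCommGroup H] [InnerProductSpace 𝕜 H] {T : ℝ}
  {ν : Measure S} {p : Ω → Measure (S × Time T)} {P : Measure Ω} {𝓕 : Filtration (Time T) mΩ}
  [IsProbabilityMeasure P] [SigmaFinite ν] [NormedSpace ℝ H] [CompleteSpace H]

/-- The Itô isometry on the closure of the elementary integral, which makes this closure a graph. -/
theorem norm_eq_of_mem_closure_elementaryGraph (hT : 0 ≤ T)
    (hp : IsPoissonRandomMeasure p (intensity ν T) P) (h𝓕 : IsGeneratedFiltration P p ν 𝓕)
    {z : L2Product P ν T H × L2Omega P H}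
    (hz : z ∈ (elementaryGraph 𝕜 P ν p 𝓕 H ⟨T, hT, le_rfl⟩).topologicalClosure) :
    ‖z.2‖ = ‖z.1‖ := by
  have hcl : IsClosed {z : L2Product P ν T H × L2Omega P H | ‖z.2‖ = ‖z.1‖} :=
    isClosed_eq (by fun_prop) (by fun_prop)
  refine closure_minimal (fun y hy => ?_) hcl hz
  have hy' := elementaryGraph_le_simpleGraph hT hp h𝓕 hy
  have h := simpleGraph_isometry hp hy' hy'
  rw [inner_self_eq_norm_sq_to_K, inner_self_eq_norm_sq_to_K] at h
  exact (sq_eq_sq₀ (norm_nonneg _) (norm_nonneg _)).1 (by exact_mod_cast h)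

/-- The domain of the Itô integral is closed: it contains all limits of elementary integrands. -/
theorem map_fst_closure_elementaryGraph (hT : 0 ≤ T)
    (hp : IsPoissonRandomMeasure p (intensity ν T) P) (h𝓕 : IsGeneratedFiltration P p ν 𝓕) :
    ((elementaryGraph 𝕜 P ν p 𝓕 H ⟨T, hT, le_rfl⟩).map
      (LinearMap.fst 𝕜 (L2Product P ν T H) (L2Omega P H))).topologicalClosure ≤
    (elementaryGraph 𝕜 P ν p 𝓕 H ⟨T, hT, le_rfl⟩).topologicalClosure.map
      (LinearMap.fst 𝕜 _ _) := by
  set G := (elementaryGraph 𝕜 P ν p 𝓕 H ⟨T, hT, le_rfl⟩).topologicalClosure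
  -- By the isometry, the projection of the closed graph to the integrands is an isometry.
  have hiso : Isometry fun z : G => z.1.1 := by
    refine AddMonoidHomClass.isometry_of_norm
      ((LinearMap.fst 𝕜 (L2Product P ν T H) (L2Omega P H)).comp G.subtype) fun z => ?_
    change ‖z.1.1‖ = ‖z.1‖
    rw [Prod.norm_def, norm_eq_of_mem_closure_elementaryGraph hT hp h𝓕 z.2, max_self]
  have : CompleteSpace G :=
    (Submodule.isClosed_topologicalClosure _).completeSpace_coe
  have hr := hiso.isClosedEmbedding.isClosed_range
  refine Submodule.topologicalClosure_minimal _
    (Submodule.map_mono (Submodule.le_topologicalClosure _)) ?_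
  convert hr using 1
  ext x
  constructor
  · rintro ⟨z, hz, rfl⟩
    exact ⟨⟨z, hz⟩, rfl⟩
  · rintro ⟨z, rfl⟩
    exact ⟨z, z.2, rfl⟩

/-- The duality `⟪I(Φ), F⟫ = ⟪Φ, D F⟫`, for all `Φ` in the domain of the Itô integral and all `F`
in the domain of the Malliavin derivative. -/
theorem inner_closure_cylindricalGraph_closure_elementaryGraph (hT : 0 ≤ T)
    (hp : IsPoissonRandomMeasure p (intensity ν T) P) (h𝓕 : IsGeneratedFiltration P p ν 𝓕)
    {w : L2Omega P H × L2Product P ν T H} {z : L2Product P ν T H × L2Omega P H}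
    (hw : w ∈ (cylindricalGraph 𝕜 P ν p H).topologicalClosure)
    (hz : z ∈ (elementaryGraph 𝕜 P ν p 𝓕 H ⟨T, hT, le_rfl⟩).topologicalClosure) :
    inner 𝕜 z.2 w.1 = inner 𝕜 z.1 w.2 := by
  have hcl : IsClosed {x : (L2Omega P H × L2Product P ν T H) × (L2Product P ν T H × L2Omega P H) |
      inner 𝕜 x.2.2 x.1.1 = inner 𝕜 x.2.1 x.1.2} :=
    isClosed_eq (by fun_prop) (by fun_prop)
  have hmem : (w, z) ∈ closure ((cylindricalGraph 𝕜 P ν p H : Set _) ×ˢ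
      (elementaryGraph 𝕜 P ν p 𝓕 H ⟨T, hT, le_rfl⟩ : Set _)) := by
    rw [closure_prod_eq]
    exact ⟨hw, hz⟩
  refine closure_minimal (fun y hy => ?_) hcl hmem
  have h := inner_cylindricalGraph_simpleGraph hp hy.1
    (elementaryGraph_le_simpleGraph hT hp h𝓕 hy.2)
  rw [Set.mem_ofPred_eq, ← inner_conj_symm y.2.2, ← inner_conj_symm y.2.1, h]

end Closure

end PoissonMalliavin

end

theorem proposition2p6 {𝕜 H Ω S : Type*} [RCLike 𝕜]
    [NormedAddCommGroup H] [InnerProductSpace 𝕜 H] [CompleteSpace H]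
    [TopologicalSpace.SeparableSpace H]
    {mΩ : MeasurableSpace Ω} [MeasurableSpace S] {T : ℝ} (hT : 0 < T)
    (P : Measure Ω) [IsProbabilityMeasure P] (ν : Measure S) [SigmaFinite ν]
    (p : Ω → Measure (S × PoissonMalliavin.Time T))
    (hp : PoissonMalliavin.IsPoissonRandomMeasure p (PoissonMalliavin.intensity ν T) P)
    (𝓕 : Filtration (PoissonMalliavin.Time T) mΩ)
    (h𝓕 : PoissonMalliavin.IsGeneratedFiltration P p ν 𝓕)
    (hΩ : mΩ ≤ PoissonMalliavin.augmented P
      (PoissonMalliavin.generatedSigma p ν ⟨T, hT.le, le_rfl⟩))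
    (Φ : PoissonMalliavin.L2Product P ν T H)
    (hΦ : Φ ∈ PoissonMalliavin.predictableL2 𝕜 P ν 𝓕 H) :
    ∃ (hδ : Φ ∈ (PoissonMalliavin.divergence 𝕜 P ν p H).domain)
      (hI : Φ ∈ (PoissonMalliavin.itoIntegral 𝕜 P ν p 𝓕 H ⟨T, hT.le, le_rfl⟩).domain),
      PoissonMalliavin.divergence 𝕜 P ν p H ⟨Φ, hδ⟩ =
        PoissonMalliavin.itoIntegral 𝕜 P ν p 𝓕 H ⟨T, hT.le, le_rfl⟩ ⟨Φ, hI⟩ := by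
  let : NormedSpace ℝ H := NormedSpace.restrictScalars ℝ 𝕜 H
  have hI : Φ ∈ (PoissonMalliavin.itoIntegral 𝕜 P ν p 𝓕 H ⟨T, hT.le, le_rfl⟩).domain :=
    PoissonMalliavin.map_fst_closure_elementaryGraph hT.le hp h𝓕
      (PoissonMalliavin.predictableL2_le_closure hT.le hp h𝓕 hΦ)
  have hIgraph := Submodule.mem_graph_toLinearPMap
    (g := (PoissonMalliavin.elementaryGraph 𝕜 P ν p 𝓕 H ⟨T, hT.le, le_rfl⟩).topologicalClosure)
    (fun z hz h0 => norm_eq_zero.1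
      ((PoissonMalliavin.norm_eq_of_mem_closure_elementaryGraph hT.le hp h𝓕 hz).trans
        (by rw [h0, norm_zero]))) ⟨Φ, hI⟩
  have hD := Submodule.mem_graph_toLinearPMap
    (PoissonMalliavin.cylindricalGraph_closable (𝕜 := 𝕜) (H := H) hp)
  have hadj (x : (PoissonMalliavin.malliavinDerivative 𝕜 P ν p H).domain) :
      inner 𝕜 (PoissonMalliavin.itoIntegral 𝕜 P ν p 𝓕 H ⟨T, hT.le, le_rfl⟩ ⟨Φ, hI⟩)
        (x : PoissonMalliavin.L2Omega P H)
        = inner 𝕜 Φ (PoissonMalliavin.malliavinDerivative 𝕜 P ν p H x) :=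
    PoissonMalliavin.inner_closure_cylindricalGraph_closure_elementaryGraph hT.le hp h𝓕
      (hD x) hIgraph
  have hdense : Dense ((PoissonMalliavin.malliavinDerivative 𝕜 P ν p H).domain :
      Set (PoissonMalliavin.L2Omega P H)) :=
    (PoissonMalliavin.cylindricalGraph_dense (𝕜 := 𝕜) (H := H) hp hΩ).mono
      (Submodule.map_mono (Submodule.le_topologicalClosure _))
  have hδ : Φ ∈ (PoissonMalliavin.divergence 𝕜 P ν p H).domain :=
    LinearPMap.mem_adjoint_domain_of_exists _ ⟨_, hadj⟩
  exact ⟨hδ, hI, LinearPMap.adjoint_apply_eq hdense ⟨Φ, hδ⟩ hadj⟩
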